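/- Let $\lambda_0,\lambda_1>0$ satisfy $e^{-\lambda_0}+e^{-\lambda_1}\le 1$ (the open set condition), and let $f_0(x)=e^{-\lambda_0}x$, $f_1(x)=e^{-\lambda_1}x+1-e^{-\lambda_1}$. For $\omega=(\omega_k)_{k\ge1}\in\{0,1\}^{\mathbb N}$ put $\pi(\omega)=\lim_{n\to\infty}f_{\omega_1}\circ f_{\omega_2}\circ\cdots\circ f_{\omega_n}(0)$, and for $\alpha\in[0,1]$ let $$L=\pi\big(\{\omega:\ \omega_k\omega_{2k}=0\text{ for all }k\ge1\}\big),\qquad L_\alpha=\pi\Big(\Big\{\omega:\ \lim_{n\to\infty}\tfrac1n\sum_{k=1}^n\omega_k\omega_{2k}=\alpha\Big\}\Big).$$ Then $$\dim_H L=\dim_H L_0=-\frac{\log(1-p)}{\lambda_0},$$ where $p$ is the unique solution in $[0,1]$ of the equation $p^{2\lambda_0}=(1-p)^{2\lambda_1+\lambda_0}$. For every $\alpha\in(0,1)$, $$\dim_H L_\alpha=\frac{\alpha\log\frac{p(1-q)}{(1-p)q}-2\log(1-p)}{2\lambda_0},$$ where $(p,q)$ is the unique solution in $[0,1]^2$ (among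 the pairs for which the logarithms are defined, i.e. in $(0,1)^2$) of the system $$\begin{cases}\alpha(\lambda_1-\lambda_0)\log\frac{p(1-q)}{(1-p)q}+\lambda_0\log\frac{p^2(1-q)}{1-p}-2\lambda_1\log(1-p)=0,\\[2pt] 2pq=\alpha(2+p-q).\end{cases}$$ For $\alpha=1$ the only $(p,q)\in[0,1]^2$ with $2pq=\alpha(2+p-q)$ is $(1,1)$, where the formula is to be read as its limit as $\alpha\to1^-$, which is $0$; that is, $\lim_{\alpha\to1^-}\dim_H L_\alpha=0$ and $\dim_H L_1=0$. -/

import Mathlib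

open Filter Topology

namespace MultipleErgodicIFS

/-- The two contractions `f₀ x = e^{-l₀} x` and `f₁ x = e^{-l₁} x + 1 - e^{-l₁}`. -/
noncomputable def ifs (l₀ l₁ : ℝ) (i : Fin 2) (x : ℝ) : ℝ :=
  if i = 0 then Real.exp (-l₀) * x else Real.exp (-l₁) * x + 1 - Real.exp (-l₁)

/-- The symbolic space `{0,1}^ℕ`. The letters of a sequence `ω₁ ω₂ ω₃ …` are stored as
`ω 0, ω 1, ω 2, …`. -/
abbrev Seq : Type := ℕ → Fin 2

/-- The letter `ω_k` (for `k ≥ 1`), as a natural number. -/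
def letter (ω : Seq) (k : ℕ) : ℕ := (ω (k - 1) : ℕ)

/-- The composition `f_{ω₁} ∘ f_{ω₂} ∘ ⋯ ∘ f_{ω_n}`. -/
noncomputable def compFirst (l₀ l₁ : ℝ) (ω : Seq) : ℕ → ℝ → ℝ
  | 0 => id
  | n + 1 => compFirst l₀ l₁ ω n ∘ ifs l₀ l₁ (ω n)

/-- The natural projection `π(ω) = lim_n f_{ω₁} ∘ ⋯ ∘ f_{ω_n} (0)`
(the limit exists, see `tendsto_proj`). -/
noncomputable def proj (l₀ l₁ : ℝ) (ω : Seq) : ℝ :=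
  limUnder atTop (fun n : ℕ => compFirst l₀ l₁ ω n 0)

theorem ifs_mono (l₀ l₁ : ℝ) (i : Fin 2) : Monotone (ifs l₀ l₁ i) := by
  intro x y hxy
  have h0 := mul_le_mul_of_nonneg_left hxy (Real.exp_pos (-l₀)).le
  have h1 := mul_le_mul_of_nonneg_left hxy (Real.exp_pos (-l₁)).le
  unfold ifs
  split_ifs <;> linarith

theorem compFirst_mono (l₀ l₁ : ℝ) (ω : Seq) (n : ℕ) : Monotone (compFirst l₀ l₁ ω n) := by
  induction n with
  | zero => exact monotone_id
  | succ n ih => exact ih.comp (ifs_mono l₀ l₁ (ω n))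

theorem ifs_zero_nonneg {l₀ l₁ : ℝ} (h₁ : 0 < l₁) (i : Fin 2) : 0 ≤ ifs l₀ l₁ i 0 := by
  have : Real.exp (-l₁) ≤ 1 := Real.exp_le_one_iff.2 (by linarith)
  unfold ifs
  split_ifs <;> simp [this]

theorem ifs_one_le {l₀ l₁ : ℝ} (h₀ : 0 < l₀) (i : Fin 2) : ifs l₀ l₁ i 1 ≤ 1 := by
  have : Real.exp (-l₀) ≤ 1 := Real.exp_le_one_iff.2 (by linarith)
  unfold ifs
  split_ifs <;> linarith

theorem compFirst_one_le {l₀ l₁ : ℝ} (h₀ : 0 < l₀) (ω : Seq) (n : ℕ) :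
    compFirst l₀ l₁ ω n 1 ≤ 1 := by
  induction n with
  | zero => exact le_refl _
  | succ n ih => exact (compFirst_mono l₀ l₁ ω n (ifs_one_le h₀ (ω n))).trans ih

/-- The limit in the definition of the projection exists. -/
theorem tendsto_proj {l₀ l₁ : ℝ} (h₀ : 0 < l₀) (h₁ : 0 < l₁) (ω : Seq) :
    Tendsto (fun n : ℕ => compFirst l₀ l₁ ω n 0) atTop (𝓝 (proj l₀ l₁ ω)) := by
  apply tendsto_nhds_limUnder
  refine ⟨_, tendsto_atTop_ciSup (monotone_nat_of_le_succ fun n => ?_) ⟨1, ?_⟩⟩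
  · exact compFirst_mono l₀ l₁ ω n (ifs_zero_nonneg h₁ (ω n))
  · rintro _ ⟨n, rfl⟩
    exact (compFirst_mono l₀ l₁ ω n zero_le_one).trans (compFirst_one_le h₀ ω n)

/-- `A = {ω : ω_k ω_{2k} = 0 for all k ≥ 1}`. -/
def setA : Set Seq :=
  {ω | ∀ k : ℕ, 1 ≤ k → letter ω k * letter ω (2 * k) = 0}

/-- `A_α = {ω : (1/n) ∑_{k=1}^n ω_k ω_{2k} → α}`. -/
def setAlevel (α : ℝ) : Set Seq :=
  {ω | Tendsto (fun n : ℕ => (1 / (n : ℝ)) *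
    ∑ k ∈ Finset.Icc 1 n, (letter ω k : ℝ) * (letter ω (2 * k) : ℝ)) atTop (𝓝 α)}

/-- `L = π(A)`. -/
noncomputable def setL (l₀ l₁ : ℝ) : Set ℝ := proj l₀ l₁ '' setA

/-- `L_α = π(A_α)`. -/
noncomputable def setLlevel (l₀ l₁ α : ℝ) : Set ℝ := proj l₀ l₁ '' setAlevel α

/-- `p ∈ [0,1]` solves `p^{2l₀} = (1-p)^{2l₁+l₀}`. -/
def IsRootP (l₀ l₁ p : ℝ) : Prop :=
  p ∈ Set.Icc (0 : ℝ) 1 ∧ p ^ (2 * l₀) = (1 - p) ^ (2 * l₁ + l₀)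

/-- `(p, q) ∈ [0,1]²` solves the two-equation system. The two positivity conditions say that all
the quotients and logarithms in the system are defined. -/
def IsSolutionPQ (l₀ l₁ α p q : ℝ) : Prop :=
  p ∈ Set.Icc (0 : ℝ) 1 ∧ q ∈ Set.Icc (0 : ℝ) 1 ∧
  0 < p * (1 - q) ∧ 0 < (1 - p) * q ∧
  α * (l₁ - l₀) * Real.log (p * (1 - q) / ((1 - p) * q)) +
    l₀ * Real.log (p ^ 2 * (1 - q) / (1 - p)) - 2 * l₁ * Real.log (1 - p) = 0 ∧
  2 * p * q = α * (2 + p - q)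

end MultipleErgodicIFS

namespace MultipleErgodicIFS

/-! The constraint links a position only with its double. A matrix `P` therefore gives each finite
word a weight `mass`: every letter is drawn from the row of the letter at half its position, with
letter 0 as dummy parent at odd positions. The n-th basic interval has length exp(-`expoSum`), so
dimensions come from comparing `mass` with powers of this length.

Upper bound (`dimH_setLlevel_le`). Take P(a,b) = exp(t·ab - s·λ_b + V(b)/2 - V(a)) with row sums at
most 1. In the mass of a word of length 2j the V-terms combine to j·(u(2j) - u(j)) - j·V(0), where u
is a running average. A bounded u cannot drop by a fixed amount at every doubling, and j·V(0) is
paid for by t times the number of pairs if V(0) ≤ tα. So infinitely many cylinders around each point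
have mass almost at least length^s, and they form an efficient cover.

Lower bound (`IsStochastic.le_dimH_of_entropy`). A stochastic P defines a random sequence. A law of
large numbers gives its letter and pair frequencies, and entropy over Lyapunov exponent bounds the
dimension of any projected set of full measure; the open set condition bounds the overlaps.

For 0 < α < 1 the system in (p, q) says that one stochastic matrix has the exponential form above,
with V(0) = tα, and has pair frequency α (`IsGibbs`), so both bounds give s. Existence is an
intermediate value argument; uniqueness follows from positivity of relative entropy. At α = 0 the
lower bound uses q = 0 and the upper bound a limit t → -∞; near α = 1 explicit parameters give
arbitrarily small upper bounds. -/

/-! ### Words, parents and masses -/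

/-- The letter at half the position of the letter with index `k`, or `0` if `k + 1` is odd. -/
def parent (ω : Seq) (k : ℕ) : Fin 2 := if Even k then 0 else ω (k / 2)

/-- The weight of the cylinder of the first `n` letters of `ω` for the transition matrix `P`. -/
noncomputable def mass (P : Fin 2 → Fin 2 → ℝ) (ω : Seq) (n : ℕ) : ℝ :=
  ∏ k ∈ Finset.range n, P (parent ω k) (ω k)

/-- Continuation of a finite word by zeros. -/
def extend {n : ℕ} (w : Fin n → Fin 2) : Seq := fun k => if h : k < n then w ⟨k, h⟩ else 0

theorem extend_of_lt {n k : ℕ} (w : Fin n → Fin 2) (h : k < n) : extend w k = w ⟨k, h⟩ :=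
  dif_pos h

theorem extend_restrict (ω : Seq) (n : ℕ) {k : ℕ} (h : k < n) :
    extend (fun i : Fin n => ω i) k = ω k := extend_of_lt _ h

theorem extend_snoc {n : ℕ} (w : Fin n → Fin 2) (b : Fin 2) :
    extend (Fin.snoc (α := fun _ => Fin 2) w b : Fin (n + 1) → Fin 2) =
      Function.update (extend w) n b := by
  funext k
  by_cases hk : k = n
  · subst hk
    simp [extend, Fin.snoc]
  · by_cases h : k < n
    · have h' : k < n + 1 := by omega
      simp [extend, Fin.snoc, h, h', hk]
    · have h' : ¬ k < n + 1 := by omega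
      simp [extend, h, h', hk]

theorem parent_congr {ω ω' : Seq} {k : ℕ} (h : ∀ i < k, ω i = ω' i) :
    parent ω k = parent ω' k := by
  unfold parent
  split_ifs with hk
  · rfl
  · refine h _ (Nat.div_lt_self ?_ one_lt_two)
    rcases Nat.eq_zero_or_pos k with rfl | h
    · simp at hk
    · exact h

theorem parent_update (ω : Seq) (k : ℕ) (b : Fin 2) :
    parent (Function.update ω k b) k = parent ω k :=
  parent_congr fun _ hi => Function.update_of_ne hi.ne _ _

theorem mass_congr (P : Fin 2 → Fin 2 → ℝ) {ω ω' : Seq} {n : ℕ} (h : ∀ i < n, ω i = ω' i) :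
    mass P ω n = mass P ω' n := by
  refine Finset.prod_congr rfl fun k hk => ?_
  rw [Finset.mem_range] at hk
  rw [parent_congr fun i hi => h i (hi.trans hk), h k hk]

theorem mass_nonneg {P : Fin 2 → Fin 2 → ℝ} (hP : ∀ a b, 0 ≤ P a b) (ω : Seq) (n : ℕ) :
    0 ≤ mass P ω n := Finset.prod_nonneg fun _ _ => hP _ _

/-- A sum over words of products of nonnegative factors with bounded one-step sums. -/
theorem sum_words_prod_le {C : ℝ} (hC : 0 ≤ C) (G : ℕ → Seq → ℝ) (hG : ∀ k ω, 0 ≤ G k ω)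
    (hdep : ∀ k ω ω', (∀ i ≤ k, ω i = ω' i) → G k ω = G k ω')
    (hstep : ∀ k ω, ∑ b, G k (Function.update ω k b) ≤ C) (n : ℕ) :
    ∑ w : Fin n → Fin 2, ∏ k ∈ Finset.range n, G k (extend w) ≤ C ^ n := by
  induction n with
  | zero => simp
  | succ n ih =>
    rw [← (Fin.snocEquiv (fun _ : Fin (n + 1) => Fin 2)).sum_comp, Fintype.sum_prod_type,
      Finset.sum_comm]
    calc ∑ w : Fin n → Fin 2, ∑ b : Fin 2, ∏ k ∈ Finset.range (n + 1),
          G k (extend (Fin.snoc (α := fun _ => Fin 2) w b : Fin (n + 1) → Fin 2))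
        = ∑ w : Fin n → Fin 2, (∏ k ∈ Finset.range n, G k (extend w)) *
            ∑ b, G n (Function.update (extend w) n b) := by
          refine Finset.sum_congr rfl fun w _ => ?_
          rw [Finset.mul_sum]
          refine Finset.sum_congr rfl fun b _ => ?_
          rw [Finset.prod_range_succ, extend_snoc]
          congr 1
          refine Finset.prod_congr rfl fun k hk => hdep k _ _ fun i hi => ?_
          rw [Finset.mem_range] at hk
          exact Function.update_of_ne (by omega) _ _
      _ ≤ ∑ w : Fin n → Fin 2, (∏ k ∈ Finset.range n, G k (extend w)) * C :=
          Finset.sum_le_sum fun w _ => mul_le_mul_of_nonneg_left (hstep _ _)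
            (Finset.prod_nonneg fun _ _ => hG _ _)
      _ ≤ C ^ (n + 1) := by
          rw [← Finset.sum_mul, pow_succ]
          exact mul_le_mul_of_nonneg_right ih hC

theorem sum_words_mass_le {P : Fin 2 → Fin 2 → ℝ} (hP : ∀ a b, 0 ≤ P a b)
    (hP1 : ∀ a, ∑ b, P a b ≤ 1) (n : ℕ) : ∑ w : Fin n → Fin 2, mass P (extend w) n ≤ 1 := by
  have := sum_words_prod_le zero_le_one (fun k ω => P (parent ω k) (ω k)) (fun _ _ => hP _ _)
    (fun k ω ω' h => by
      rw [parent_congr fun i hi => h i hi.le, h k le_rfl])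
    (fun k ω => by simpa [parent_update] using hP1 (parent ω k)) n
  simpa [mass] using this

/-- Sums of `F (parent ω k)` over `k < n` in terms of the first half of `ω`. -/
theorem sum_parent (F : Fin 2 → ℝ) (ω : Seq) (n : ℕ) :
    ∑ k ∈ Finset.range n, F (parent ω k) =
      n * F 0 + (F 1 - F 0) * ∑ i ∈ Finset.range (n / 2), ((ω i : ℕ) : ℝ) := by
  have key : ∀ a : Fin 2, F a = F 0 + (F 1 - F 0) * ((a : ℕ) : ℝ) := by
    intro a
    fin_cases a <;> simp
  have hev : ∀ j : ℕ, ∑ k ∈ Finset.range (2 * j), ((parent ω k : ℕ) : ℝ) =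
      ∑ i ∈ Finset.range j, ((ω i : ℕ) : ℝ) := by
    intro j
    induction j with
    | zero => simp
    | succ j ih =>
      rw [show 2 * (j + 1) = 2 * j + 1 + 1 by ring, Finset.sum_range_succ, Finset.sum_range_succ,
        ih, Finset.sum_range_succ]
      have h1 : parent ω (2 * j) = 0 := by simp [parent]
      have h2 : parent ω (2 * j + 1) = ω j := by
        have : (2 * j + 1) / 2 = j := by omega
        simp [parent, this]
      rw [h1, h2]
      simp
  have hall : ∑ k ∈ Finset.range n, ((parent ω k : ℕ) : ℝ) =
      ∑ i ∈ Finset.range (n / 2), ((ω i : ℕ) : ℝ) := by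
    rcases Nat.even_or_odd' n with ⟨j, rfl | rfl⟩
    · rw [hev, show 2 * j / 2 = j by omega]
    · rw [Finset.sum_range_succ, hev, show (2 * j + 1) / 2 = j by omega]
      simp [parent]
  rw [← hall, Finset.mul_sum, Finset.sum_congr rfl fun k _ => key (parent ω k),
    Finset.sum_add_distrib]
  simp

/-! ### Geometry of the basic intervals -/

/-- The ratio exponent of the letter `i`. -/
noncomputable def expo (l₀ l₁ : ℝ) (i : Fin 2) : ℝ := if i = 0 then l₀ else l₁

/-- The sum of the exponents of the first `n` letters. -/
noncomputable def expoSum (l₀ l₁ : ℝ) (ω : Seq) (n : ℕ) : ℝ :=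
  ∑ k ∈ Finset.range n, expo l₀ l₁ (ω k)

theorem expoSum_succ (l₀ l₁ : ℝ) (ω : Seq) (n : ℕ) :
    expoSum l₀ l₁ ω (n + 1) = expoSum l₀ l₁ ω n + expo l₀ l₁ (ω n) :=
  Finset.sum_range_succ _ _

theorem expo_pos {l₀ l₁ : ℝ} (h₀ : 0 < l₀) (h₁ : 0 < l₁) (i : Fin 2) : 0 < expo l₀ l₁ i := by
  unfold expo
  split_ifs <;> assumption

theorem min_le_expo (l₀ l₁ : ℝ) (i : Fin 2) : min l₀ l₁ ≤ expo l₀ l₁ i := by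
  unfold expo
  split_ifs
  exacts [min_le_left _ _, min_le_right _ _]

theorem expo_le_max (l₀ l₁ : ℝ) (i : Fin 2) : expo l₀ l₁ i ≤ max l₀ l₁ := by
  unfold expo
  split_ifs
  exacts [le_max_left _ _, le_max_right _ _]

theorem mul_min_le_expoSum (l₀ l₁ : ℝ) (ω : Seq) (n : ℕ) :
    n * min l₀ l₁ ≤ expoSum l₀ l₁ ω n := by
  simpa [expoSum] using
    Finset.card_nsmul_le_sum (Finset.range n) _ _ fun k _ => min_le_expo l₀ l₁ (ω k)

theorem expoSum_le_mul_max (l₀ l₁ : ℝ) (ω : Seq) (n : ℕ) :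
    expoSum l₀ l₁ ω n ≤ n * max l₀ l₁ := by
  simpa [expoSum] using
    Finset.sum_le_card_nsmul (Finset.range n) _ _ fun k _ => expo_le_max l₀ l₁ (ω k)

theorem expoSum_congr (l₀ l₁ : ℝ) {ω ω' : Seq} {n : ℕ} (h : ∀ i < n, ω i = ω' i) :
    expoSum l₀ l₁ ω n = expoSum l₀ l₁ ω' n :=
  Finset.sum_congr rfl fun k hk => by rw [h k (Finset.mem_range.1 hk)]

theorem compFirst_congr (l₀ l₁ : ℝ) {ω ω' : Seq} {n : ℕ} (h : ∀ i < n, ω i = ω' i) :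
    compFirst l₀ l₁ ω n = compFirst l₀ l₁ ω' n := by
  induction n with
  | zero => rfl
  | succ n ih => rw [compFirst, compFirst, ih fun i hi => h i (by omega), h n (by omega)]

theorem ifs_eq (l₀ l₁ : ℝ) (i : Fin 2) (x : ℝ) :
    ifs l₀ l₁ i x = ifs l₀ l₁ i 0 + Real.exp (-expo l₀ l₁ i) * x := by
  unfold ifs expo
  split_ifs <;> ring

theorem compFirst_eq (l₀ l₁ : ℝ) (ω : Seq) (n : ℕ) (x : ℝ) :
    compFirst l₀ l₁ ω n x = compFirst l₀ l₁ ω n 0 + Real.exp (-expoSum l₀ l₁ ω n) * x := by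
  induction n generalizing x with
  | zero => simp [compFirst, expoSum]
  | succ n ih =>
    simp only [compFirst, Function.comp_apply]
    rw [ih, ih (ifs l₀ l₁ (ω n) 0), ifs_eq, expoSum_succ, neg_add, Real.exp_add]
    ring

theorem compFirst_zero_mono {l₀ l₁ : ℝ} (h₁ : 0 < l₁) (ω : Seq) :
    Monotone fun n => compFirst l₀ l₁ ω n 0 :=
  monotone_nat_of_le_succ fun n => compFirst_mono l₀ l₁ ω n (ifs_zero_nonneg h₁ (ω n))

theorem compFirst_one_anti {l₀ l₁ : ℝ} (h₀ : 0 < l₀) (ω : Seq) :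
    Antitone fun n => compFirst l₀ l₁ ω n 1 :=
  antitone_nat_of_succ_le fun n => compFirst_mono l₀ l₁ ω n (ifs_one_le h₀ (ω n))

theorem proj_mem_Icc {l₀ l₁ : ℝ} (h₀ : 0 < l₀) (h₁ : 0 < l₁) (ω : Seq) (n : ℕ) :
    proj l₀ l₁ ω ∈ Set.Icc (compFirst l₀ l₁ ω n 0) (compFirst l₀ l₁ ω n 1) := by
  constructor
  · exact (compFirst_zero_mono h₁ ω).ge_of_tendsto (tendsto_proj h₀ h₁ ω) n
  · refine le_of_tendsto (tendsto_proj h₀ h₁ ω) ?_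
    filter_upwards [eventually_ge_atTop n] with m hm
    exact (compFirst_mono l₀ l₁ ω m zero_le_one).trans (compFirst_one_anti h₀ ω hm)

/-- The open set condition orders the basic intervals of incomparable words. -/
theorem compFirst_one_le_compFirst_zero {l₀ l₁ : ℝ} (h₀ : 0 < l₀) (h₁ : 0 < l₁)
    (hosc : Real.exp (-l₀) + Real.exp (-l₁) ≤ 1) {ω ω' : Seq} {k m n : ℕ}
    (h : ∀ i < k, ω i = ω' i) (hω : ω k = 0) (hω' : ω' k = 1) (hm : k < m) (hn : k < n) :
    compFirst l₀ l₁ ω m 1 ≤ compFirst l₀ l₁ ω' n 0 := by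
  calc compFirst l₀ l₁ ω m 1 ≤ compFirst l₀ l₁ ω (k + 1) 1 := compFirst_one_anti h₀ ω hm
    _ ≤ compFirst l₀ l₁ ω' (k + 1) 0 := by
      simp only [compFirst, Function.comp_apply]
      rw [compFirst_congr l₀ l₁ h]
      apply compFirst_mono
      rw [hω, hω']
      simp [ifs]
      linarith
    _ ≤ compFirst l₀ l₁ ω' n 0 := compFirst_zero_mono h₁ ω' hn

theorem measurable_compFirst (l₀ l₁ : ℝ) (n : ℕ) (x : ℝ) :
    Measurable fun ω => compFirst l₀ l₁ ω n x := by
  induction n generalizing x with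
  | zero => exact measurable_const
  | succ n ih =>
    have : (fun ω => compFirst l₀ l₁ ω (n + 1) x) = fun ω : Seq =>
        if ω n = 0 then compFirst l₀ l₁ ω n (ifs l₀ l₁ 0 x)
        else compFirst l₀ l₁ ω n (ifs l₀ l₁ 1 x) := by
      funext ω
      simp only [compFirst, Function.comp_apply]
      split_ifs with h
      · rw [h]
      · rw [Fin.eq_one_of_ne_zero _ h]
    rw [this]
    exact Measurable.ite (measurable_pi_apply n (measurableSet_singleton 0)) (ih _) (ih _)

theorem measurable_proj {l₀ l₁ : ℝ} (h₀ : 0 < l₀) (h₁ : 0 < l₁) : Measurable (proj l₀ l₁) :=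
  measurable_of_tendsto_metrizable (fun n => measurable_compFirst l₀ l₁ n 0)
    (tendsto_pi_nhds.2 fun ω => tendsto_proj h₀ h₁ ω)

/-! ### Covering by cylinders -/

/-- All sequences that begin with the first `n` letters of `w`. -/
def cylinder (w : Seq) (n : ℕ) : Set Seq := {ω | ∀ k < n, ω k = w k}

theorem ediam_proj_cylinder_le {l₀ l₁ : ℝ} (h₀ : 0 < l₀) (h₁ : 0 < l₁) (w : Seq) (n : ℕ) :
    Metric.ediam (proj l₀ l₁ '' cylinder w n) ≤
      ENNReal.ofReal (Real.exp (-expoSum l₀ l₁ w n)) := by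
  have hsub : proj l₀ l₁ '' cylinder w n ⊆
      Set.Icc (compFirst l₀ l₁ w n 0) (compFirst l₀ l₁ w n 1) := by
    rintro _ ⟨ω, hω, rfl⟩
    have := proj_mem_Icc h₀ h₁ ω n
    rwa [compFirst_congr l₀ l₁ hω] at this
  refine (Metric.ediam_mono hsub).trans ?_
  rw [Real.ediam_Icc, compFirst_eq l₀ l₁ w n 1]
  simp

/-- The extra exponent δ yields a factor geometric in n, which makes the cover summable over all
lengths even though the masses of each single length may sum to 1. -/
theorem ediam_proj_cylinder_rpow_le {l₀ l₁ s δ M : ℝ} (h₀ : 0 < l₀) (h₁ : 0 < l₁) (hs : 0 ≤ s)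
    (hδ : 0 < δ) (w : Seq) (n : ℕ) (hM : Real.exp (-(s * expoSum l₀ l₁ w n)) ≤ M) :
    Metric.ediam (proj l₀ l₁ '' cylinder w n) ^ (s + δ) ≤
      ENNReal.ofReal (M * Real.exp (-(δ * min l₀ l₁)) ^ n) := by
  refine (ENNReal.rpow_le_rpow (ediam_proj_cylinder_le h₀ h₁ w n) (by positivity)).trans ?_
  rw [ENNReal.ofReal_rpow_of_pos (Real.exp_pos _), ← Real.exp_mul, ← Real.exp_nat_mul]
  apply ENNReal.ofReal_le_ofReal
  have h1 : δ * (n * min l₀ l₁) ≤ δ * expoSum l₀ l₁ w n :=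
    mul_le_mul_of_nonneg_left (mul_min_le_expoSum l₀ l₁ w n) hδ.le
  calc Real.exp (-expoSum l₀ l₁ w n * (s + δ))
      = Real.exp (-(s * expoSum l₀ l₁ w n)) * Real.exp (-(δ * expoSum l₀ l₁ w n)) := by
        rw [← Real.exp_add]
        ring_nf
    _ ≤ M * Real.exp (n * -(δ * min l₀ l₁)) := by
        gcongr
        · exact (Real.exp_pos _).le.trans hM
        · linarith

/-- If infinitely many cylinders around each point of `E` have weight at least their diameter to
the power `s`, then the projection of `E` has dimension at most `s`. -/
theorem dimH_le_of_frequently_le_mass {l₀ l₁ s : ℝ} (h₀ : 0 < l₀) (h₁ : 0 < l₁) (hs : 0 ≤ s)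
    {P : Fin 2 → Fin 2 → ℝ} (hP : ∀ a b, 0 ≤ P a b) (hP1 : ∀ a, ∑ b, P a b ≤ 1) {E : Set Seq}
    (hE : ∀ ω ∈ E, ∃ᶠ n in atTop, Real.exp (-(s * expoSum l₀ l₁ ω n)) ≤ mass P ω n) :
    dimH (proj l₀ l₁ '' E) ≤ ENNReal.ofReal s := by
  classical
  refine ENNReal.le_of_forall_pos_le_add fun δ hδ _ => ?_
  have hδ' : (0 : ℝ) < δ := hδ
  have hmin : 0 < min l₀ l₁ := lt_min h₀ h₁
  set c := Real.exp (-((δ : ℝ) * min l₀ l₁)) with hc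
  have hc0 : 0 < c := Real.exp_pos _
  have hc1 : c < 1 := by
    rw [hc, Real.exp_lt_one_iff]
    nlinarith
  let good (w : Seq) (n : ℕ) : Prop := Real.exp (-(s * expoSum l₀ l₁ w n)) ≤ mass P w n
  -- The N-th cover consists of all good cylinders of length at least N, indexed by all words, with
  -- the empty set in place of the others.
  let t (N : ℕ) (x : Σ n : ℕ, (Fin n → Fin 2)) : Set ℝ :=
    if N ≤ x.1 ∧ good (extend x.2) x.1 then proj l₀ l₁ '' cylinder (extend x.2) x.1 else ∅
  have hbound : ∀ N, ∑' x, Metric.ediam (t N x) ^ (s + δ) ≤ ENNReal.ofReal (∑' n : ℕ, c ^ n) := by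
    intro N
    rw [ENNReal.tsum_sigma', ENNReal.ofReal_tsum_of_nonneg (fun n => by positivity)
      (summable_geometric_of_lt_one hc0.le hc1)]
    refine ENNReal.tsum_le_tsum fun n => ?_
    rw [tsum_fintype]
    calc ∑ w : Fin n → Fin 2, Metric.ediam (t N ⟨n, w⟩) ^ (s + δ)
        ≤ ∑ w : Fin n → Fin 2, ENNReal.ofReal (mass P (extend w) n * c ^ n) := by
          refine Finset.sum_le_sum fun w _ => ?_
          by_cases hw : N ≤ n ∧ good (extend w) n
          · simp only [t, if_pos hw]
            exact ediam_proj_cylinder_rpow_le h₀ h₁ hs hδ' _ _ hw.2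
          · simp only [t, if_neg hw]
            rw [Metric.ediam_empty, ENNReal.zero_rpow_of_pos (by positivity)]
            exact zero_le
      _ = ENNReal.ofReal ((∑ w : Fin n → Fin 2, mass P (extend w) n) * c ^ n) := by
          rw [Finset.sum_mul, ENNReal.ofReal_sum_of_nonneg]
          exact fun w _ => mul_nonneg (mass_nonneg hP _ _) (by positivity)
      _ ≤ ENNReal.ofReal (c ^ n) := by
          apply ENNReal.ofReal_le_ofReal
          exact mul_le_of_le_one_left (by positivity) (sum_words_mass_le hP hP1 n)
  have hr : Tendsto (fun N : ℕ => ENNReal.ofReal (Real.exp (-(min l₀ l₁)) ^ N)) atTop (𝓝 0) := by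
    rw [← ENNReal.ofReal_zero]
    exact ENNReal.tendsto_ofReal (tendsto_pow_atTop_nhds_zero_of_lt_one (Real.exp_pos _).le
      (Real.exp_lt_one_iff.2 (by linarith)))
  have hmeas : MeasureTheory.Measure.hausdorffMeasure (s + δ) (proj l₀ l₁ '' E) ≤
      ENNReal.ofReal (∑' n : ℕ, c ^ n) := by
    refine (MeasureTheory.Measure.hausdorffMeasure_le_liminf_tsum (s + δ) _ _ hr t ?_ ?_).trans
      (liminf_le_of_le (by isBoundedDefault) fun b hb => ?_)
    · refine Eventually.of_forall fun N x => ?_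
      by_cases hx : N ≤ x.1 ∧ good (extend x.2) x.1
      · simp only [t, if_pos hx]
        refine (ediam_proj_cylinder_le h₀ h₁ _ _).trans (ENNReal.ofReal_le_ofReal ?_)
        rw [← Real.exp_nat_mul]
        apply Real.exp_le_exp.2
        have := mul_min_le_expoSum l₀ l₁ (extend x.2) x.1
        have h2 : (N : ℝ) * min l₀ l₁ ≤ x.1 * min l₀ l₁ := by
          gcongr
          exact_mod_cast hx.1
        linarith
      · simp only [t, if_neg hx]
        simp
    · refine Eventually.of_forall fun N => ?_
      rintro _ ⟨ω, hω, rfl⟩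
      obtain ⟨n, hn, hg⟩ := frequently_atTop.1 (hE ω hω) N
      refine Set.mem_iUnion.2 ⟨⟨n, fun i : Fin n => ω i⟩, ?_⟩
      have hag : ∀ i < n, extend (fun i : Fin n => ω i) i = ω i := fun i hi =>
        extend_restrict ω n hi
      have : N ≤ n ∧ good (extend fun i : Fin n => ω i) n := by
        refine ⟨hn, ?_⟩
        simp only [good]
        rwa [expoSum_congr l₀ l₁ hag, mass_congr P hag]
      simp only [t, if_pos this]
      exact ⟨ω, fun i hi => (hag i hi).symm, rfl⟩
    · obtain ⟨N, hN⟩ := hb.exists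
      exact hN.trans (hbound N)
  have hcoe : ENNReal.ofReal s + (δ : ENNReal) = ((s.toNNReal + δ : NNReal) : ENNReal) := by
    simp [ENNReal.ofReal]
  rw [hcoe]
  refine dimH_le_of_hausdorffMeasure_ne_top ?_
  have : ((s.toNNReal + δ : NNReal) : ℝ) = s + δ := by simp [hs]
  rw [this]
  exact ne_top_of_le_ne_top ENNReal.ofReal_ne_top hmeas

/-! ### Upper bound for the level sets -/

/-- The number of `i < n` with `ω_k = ω_{2k} = 1` for `k = i + 1`. -/
def pairSum (ω : Seq) (n : ℕ) : ℝ :=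
  ∑ i ∈ Finset.range n, ((ω i : ℕ) : ℝ) * ((ω (2 * i + 1) : ℕ) : ℝ)

theorem sum_letter_mul_letter (ω : Seq) (n : ℕ) :
    ∑ k ∈ Finset.Icc 1 n, (letter ω k : ℝ) * (letter ω (2 * k) : ℝ) = pairSum ω n := by
  induction n with
  | zero => simp [pairSum]
  | succ n ih =>
    rw [Finset.sum_Icc_succ_top (by omega), ih, pairSum, pairSum, Finset.sum_range_succ]
    rfl

theorem mem_setAlevel_iff {α : ℝ} {ω : Seq} :
    ω ∈ setAlevel α ↔ Tendsto (fun n : ℕ => pairSum ω n / n) atTop (𝓝 α) := by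
  unfold setAlevel
  simp only [Set.mem_ofPred_eq, sum_letter_mul_letter, div_eq_inv_mul, mul_one]

/-- A bounded sequence cannot drop by a fixed amount at every doubling. -/
theorem frequently_sub_le_two_mul {u : ℕ → ℝ} {B ε : ℝ} (hu : ∀ n, |u n| ≤ B) (hε : 0 < ε) :
    ∃ᶠ j in atTop, -ε ≤ u (2 * j) - u j := by
  rw [frequently_atTop]
  by_contra! h
  obtain ⟨N, hN⟩ := h
  have key : ∀ i : ℕ, u (2 ^ i * N) ≤ u N - i * ε := by
    intro i
    induction i with
    | zero => simp
    | succ i ih =>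
      have := hN (2 ^ i * N) (Nat.le_mul_of_pos_left _ (by positivity))
      rw [pow_succ', mul_assoc]
      push_cast
      linarith
  obtain ⟨i, hi⟩ := exists_nat_gt (2 * B / ε)
  rw [div_lt_iff₀ hε] at hi
  have h1 := key i
  have h2 := abs_le.1 (hu N)
  have h3 := abs_le.1 (hu (2 ^ i * N))
  linarith [h2.2, h3.1]

/-- Among the first 2j indices the odd ones have as parents exactly the first j letters, and the j
even ones have the dummy parent 0. This produces the sum of V over the first j letters and the term
j·V(0). -/
theorem mass_exp_two_mul (l₀ l₁ s t : ℝ) (V : Fin 2 → ℝ) (ω : Seq) (j : ℕ) :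
    mass (fun a b => Real.exp (t * (((a : ℕ) : ℝ) * ((b : ℕ) : ℝ)) - s * expo l₀ l₁ b + V b / 2
      - V a)) ω (2 * j) =
    Real.exp (t * pairSum ω j - s * expoSum l₀ l₁ ω (2 * j) +
      (∑ k ∈ Finset.range (2 * j), V (ω k)) / 2 - ∑ k ∈ Finset.range j, V (ω k) - j * V 0) := by
  induction j with
  | zero => simp [mass, pairSum, expoSum]
  | succ j ih =>
    have h1 : parent ω (2 * j) = 0 := by simp [parent]
    have h2 : parent ω (2 * j + 1) = ω j := by
      have : (2 * j + 1) / 2 = j := by omega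
      simp [parent, this]
    rw [mass] at ih ⊢
    rw [show 2 * (j + 1) = 2 * j + 1 + 1 by ring, Finset.prod_range_succ, Finset.prod_range_succ,
      ih, h1, h2, ← Real.exp_add, ← Real.exp_add, expoSum_succ, expoSum_succ, pairSum, pairSum,
      Finset.sum_range_succ, Finset.sum_range_succ, Finset.sum_range_succ, Finset.sum_range_succ]
    congr 1
    push_cast
    simp only [Fin.val_zero, Nat.cast_zero]
    ring

/-- `hV0` and `hV1` say that the two rows of the exponential matrix have sums at most 1; t acts as a
Lagrange multiplier for the pair frequency. -/
theorem dimH_setLlevel_le {l₀ l₁ s t α : ℝ} (h₀ : 0 < l₀) (h₁ : 0 < l₁) (hs : 0 ≤ s)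
    (V : Fin 2 → ℝ)
    (hV0 : Real.exp (-(s * l₀) + V 0 / 2) + Real.exp (-(s * l₁) + V 1 / 2) ≤ Real.exp (V 0))
    (hV1 : Real.exp (-(s * l₀) + V 0 / 2) + Real.exp (t - s * l₁ + V 1 / 2) ≤ Real.exp (V 1))
    (hα : V 0 ≤ t * α) : dimH (setLlevel l₀ l₁ α) ≤ ENNReal.ofReal s := by
  refine ENNReal.le_of_forall_pos_le_add fun δ hδ _ => ?_
  have hδ' : (0 : ℝ) < δ := hδ
  have hmin : 0 < min l₀ l₁ := lt_min h₀ h₁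
  set P : Fin 2 → Fin 2 → ℝ := fun a b =>
    Real.exp (t * (((a : ℕ) : ℝ) * ((b : ℕ) : ℝ)) - s * expo l₀ l₁ b + V b / 2 - V a) with hPdef
  have hP1 : ∀ a, ∑ b, P a b ≤ 1 := by
    intro a
    have hfac : ∀ b, P a b = Real.exp (t * (((a : ℕ) : ℝ) * ((b : ℕ) : ℝ)) - s * expo l₀ l₁ b
        + V b / 2) / Real.exp (V a) := fun b => by rw [← Real.exp_sub]
    rw [Fin.sum_univ_two, hfac, hfac, ← add_div, div_le_one (Real.exp_pos _)]
    fin_cases a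
    · simpa [expo] using hV0
    · simpa [expo] using hV1
  have hsδ : ENNReal.ofReal s + (δ : ENNReal) = ENNReal.ofReal (s + δ) := by
    rw [ENNReal.ofReal_add hs hδ'.le, ENNReal.ofReal_coe_nnreal]
  rw [hsδ]
  refine dimH_le_of_frequently_le_mass h₀ h₁ (by positivity) (P := P)
    (fun a b => (Real.exp_pos _).le) hP1 fun ω hω => ?_
  rw [mem_setAlevel_iff] at hω
  -- Over 2j letters the slack δ in the exponent is worth at least 2jε. It pays for two errors of
  -- size jε: the drop of u at doubling and the deviation of the pair frequency from α.
  set ε : ℝ := δ * min l₀ l₁ with hε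
  have hε0 : 0 < ε := by positivity
  set u : ℕ → ℝ := fun n => (∑ k ∈ Finset.range n, V (ω k)) / n with hu
  have hub : ∀ n, |u n| ≤ max |V 0| |V 1| := by
    intro n
    have hV : ∀ a : Fin 2, |V a| ≤ max |V 0| |V 1| := by
      intro a
      fin_cases a
      exacts [le_max_left _ _, le_max_right _ _]
    rcases Nat.eq_zero_or_pos n with rfl | hn
    · simp [hu]
    · have hn' : (0 : ℝ) < n := by exact_mod_cast hn
      rw [hu]
      simp only
      rw [abs_div, abs_of_pos hn', div_le_iff₀ hn', mul_comm]
      calc |∑ k ∈ Finset.range n, V (ω k)| ≤ ∑ k ∈ Finset.range n, |V (ω k)| :=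
            Finset.abs_sum_le_sum_abs _ _
        _ ≤ n * max |V 0| |V 1| := by
            simpa using Finset.sum_le_card_nsmul (Finset.range n) _ _ fun k _ => hV (ω k)
  have hfreq := frequently_sub_le_two_mul hub hε0
  have hev : ∀ᶠ j : ℕ in atTop, -ε < t * (pairSum ω j / j - α) := by
    have : Tendsto (fun j : ℕ => t * (pairSum ω j / j - α)) atTop (𝓝 0) := by
      simpa using (hω.sub_const α).const_mul t
    exact this.eventually (lt_mem_nhds (by linarith))
  have hfin := (hfreq.and_eventually (hev.and (eventually_gt_atTop 0)))
  have hmul : Tendsto (fun j : ℕ => 2 * j) atTop atTop :=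
    tendsto_id.const_mul_atTop' two_pos
  refine hmul.frequently (hfin.mono ?_)
  rintro j ⟨hj1, hj2, hj0⟩
  have hj : (0 : ℝ) < j := by exact_mod_cast hj0
  rw [hPdef, mass_exp_two_mul]
  apply Real.exp_le_exp.2
  have e1 : (∑ k ∈ Finset.range (2 * j), V (ω k)) / 2 - ∑ k ∈ Finset.range j, V (ω k) =
      j * (u (2 * j) - u j) := by
    simp only [hu]
    push_cast
    field_simp
  have e2 : t * pairSum ω j - j * (t * α) = j * (t * (pairSum ω j / j - α)) := by
    field_simp
  have e3 := mul_min_le_expoSum l₀ l₁ ω (2 * j)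
  push_cast at e3
  have e4 : (δ : ℝ) * (2 * j * min l₀ l₁) ≤ δ * expoSum l₀ l₁ ω (2 * j) := by gcongr
  have e5 : (j : ℝ) * -ε ≤ j * (u (2 * j) - u j) := by gcongr
  have e6 : (j : ℝ) * -ε ≤ j * (t * (pairSum ω j / j - α)) := by gcongr
  have e7 : (j : ℝ) * V 0 ≤ j * (t * α) := by gcongr
  have e8 : (δ : ℝ) * (2 * j * min l₀ l₁) = 2 * (j * ε) := by rw [hε]; ring
  nlinarith

/-! ### The random sequence of a stochastic matrix -/

open MeasureTheory

/-- A stochastic matrix on two states. -/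
structure IsStochastic (P : Fin 2 → Fin 2 → ℝ) : Prop where
  nonneg : ∀ a b, 0 ≤ P a b
  sum_eq_one : ∀ a, ∑ b, P a b = 1

/-- The law on `{0, 1}` with the given point masses. -/
noncomputable def coin (x : Fin 2 → ℝ) : Measure (Fin 2) :=
  ∑ b, ENNReal.ofReal (x b) • Measure.dirac b

theorem coin_singleton (x : Fin 2 → ℝ) (b : Fin 2) : coin x {b} = ENNReal.ofReal (x b) := by
  fin_cases b <;> simp [coin, Fin.sum_univ_two]

theorem IsStochastic.isProbabilityMeasure_coin {P : Fin 2 → Fin 2 → ℝ} (hP : IsStochastic P)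
    (a : Fin 2) : IsProbabilityMeasure (coin (P a)) := by
  constructor
  have h := hP.sum_eq_one a
  rw [Fin.sum_univ_two] at h
  simp [coin, Fin.sum_univ_two, ← ENNReal.ofReal_add (hP.nonneg a 0) (hP.nonneg a 1), h]

/-- The sequence whose letter with index `k` is the value at `k` of the random map `g`, applied to
the parent letter. -/
def decode (g : ℕ × Fin 2 → Fin 2) (k : ℕ) : Fin 2 :=
  if h : Even k then g (k, 0) else g (k, decode g (k / 2))
termination_by k
decreasing_by
  refine Nat.div_lt_self (Nat.pos_of_ne_zero ?_) one_lt_two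
  rintro rfl
  simp at h

theorem decode_eq (g : ℕ × Fin 2 → Fin 2) (k : ℕ) :
    decode g k = g (k, parent (decode g) k) := by
  rw [decode, parent]
  split_ifs <;> rfl

theorem measurable_decode : Measurable decode := by
  refine measurable_pi_lambda _ fun k => ?_
  induction k using Nat.strong_induction_on with
  | _ k ih =>
    by_cases hk : Even k
    · have : (fun g => decode g k) = fun g => g (k, 0) := by
        funext g
        rw [decode, dif_pos hk]
      rw [this]
      exact measurable_pi_apply _
    · have hlt : k / 2 < k := by
        refine Nat.div_lt_self (Nat.pos_of_ne_zero ?_) one_lt_two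
        rintro rfl
        simp at hk
      have : (fun g => decode g k) = fun g =>
          if decode g (k / 2) = 0 then g (k, 0) else g (k, 1) := by
        funext g
        rw [decode, dif_neg hk]
        split_ifs with h
        · rw [h]
        · rw [Fin.eq_one_of_ne_zero _ h]
      rw [this]
      exact Measurable.ite (ih _ hlt (measurableSet_singleton 0)) (measurable_pi_apply _)
        (measurable_pi_apply _)

/-- A cylinder prescribes one value of g for each index below n, at the parent letter read from w
itself. These coordinates are distinct, so independence turns the probability into the product
`mass`. -/
theorem decode_mem_cylinder_iff (g : ℕ × Fin 2 → Fin 2) (w : Seq) (n : ℕ) :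
    decode g ∈ cylinder w n ↔ ∀ k < n, g (k, parent w k) = w k := by
  constructor
  · intro h k hk
    rw [← h k hk, decode_eq g k, parent_congr fun i hi => (h i (hi.trans hk)).symm]
  · intro h k
    induction k using Nat.strong_induction_on with
    | _ k ih =>
      intro hk
      rw [decode_eq, parent_congr fun i hi => ih i hi (hi.trans hk), h k hk]

/-- The law of the random sequence in which the letter at each position is chosen by `P` from the
letter at half the position. -/
noncomputable def chainMeasure (P : Fin 2 → Fin 2 → ℝ) : Measure Seq :=
  (Measure.infinitePi fun i : ℕ × Fin 2 => coin (P i.2)).map decode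

theorem measurableSet_cylinder (w : Seq) (n : ℕ) : MeasurableSet (cylinder w n) := by
  have : cylinder w n = ⋂ k, ⋂ (_ : k < n), (fun ω : Seq => ω k) ⁻¹' {w k} := by
    ext ω
    simp [cylinder]
  rw [this]
  exact MeasurableSet.iInter fun k => MeasurableSet.iInter fun _ =>
    measurable_pi_apply k (measurableSet_singleton _)

theorem IsStochastic.isProbabilityMeasure {P : Fin 2 → Fin 2 → ℝ} (hP : IsStochastic P) :
    IsProbabilityMeasure (chainMeasure P) := by
  have := fun i : ℕ × Fin 2 => hP.isProbabilityMeasure_coin i.2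
  exact Measure.isProbabilityMeasure_map measurable_decode.aemeasurable

theorem IsStochastic.chainMeasure_cylinder {P : Fin 2 → Fin 2 → ℝ} (hP : IsStochastic P)
    (w : Seq) (n : ℕ) : chainMeasure P (cylinder w n) = ENNReal.ofReal (mass P w n) := by
  classical
  have := fun i : ℕ × Fin 2 => hP.isProbabilityMeasure_coin i.2
  rw [chainMeasure, Measure.map_apply measurable_decode (measurableSet_cylinder w n)]
  have hset : decode ⁻¹' cylinder w n =
      Set.pi ((Finset.range n).image fun k => (k, parent w k) : Finset (ℕ × Fin 2))
        fun i => {w i.1} := by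
    ext g
    rw [Set.mem_preimage, decode_mem_cylinder_iff]
    simp [Set.mem_pi]
  rw [hset, Measure.infinitePi_pi _ fun i _ => measurableSet_singleton _,
    Finset.prod_image fun x _ y _ h => congrArg Prod.fst h, mass,
    ENNReal.ofReal_prod_of_nonneg fun _ _ => hP.nonneg _ _]
  exact Finset.prod_congr rfl fun k _ => coin_singleton _ _

/-! ### Law of large numbers -/

/-- Markov's inequality for functions of the first `n` letters. -/
theorem IsStochastic.chainMeasure_le_sum {P : Fin 2 → Fin 2 → ℝ} (hP : IsStochastic P) {n : ℕ}
    {S : Set Seq} {g : Seq → ℝ} (hg : ∀ ω, 0 ≤ g ω)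
    (hdep : ∀ ω ω', (∀ i < n, ω i = ω' i) → g ω = g ω') (hS : ∀ ω ∈ S, 1 ≤ g ω) :
    chainMeasure P S ≤
      ENNReal.ofReal (∑ w : Fin n → Fin 2, mass P (extend w) n * g (extend w)) := by
  classical
  have hsub : S ⊆ ⋃ w ∈ (Finset.univ.filter fun w : Fin n → Fin 2 => 1 ≤ g (extend w)),
      cylinder (extend w) n := by
    intro ω hω
    have hag : ∀ i < n, extend (fun i : Fin n => ω i) i = ω i := fun i hi =>
      extend_restrict ω n hi
    simp only [Set.mem_iUnion]
    refine ⟨fun i : Fin n => ω i, ?_, fun i hi => (hag i hi).symm⟩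
    rw [Finset.mem_filter, hdep _ _ hag]
    exact ⟨Finset.mem_univ _, hS ω hω⟩
  refine (measure_mono hsub).trans ((measure_biUnion_finset_le _ _).trans ?_)
  rw [ENNReal.ofReal_sum_of_nonneg fun w _ => mul_nonneg (mass_nonneg hP.nonneg _ _) (hg _)]
  refine (Finset.sum_le_sum fun w hw => ?_).trans
    (Finset.sum_le_sum_of_subset (Finset.filter_subset _ _))
  rw [hP.chainMeasure_cylinder]
  exact ENNReal.ofReal_le_ofReal
    (le_mul_of_one_le_right (mass_nonneg hP.nonneg _ _) (Finset.mem_filter.1 hw).2)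

/-- Exponential moment bound from e^x ≤ 1 + x + x² for |x| ≤ 1; the linear term has mean zero. -/
theorem IsStochastic.sum_mul_exp_le {P : Fin 2 → Fin 2 → ℝ} (hP : IsStochastic P)
    {h : Fin 2 → Fin 2 → ℝ} (hmean : ∀ a, ∑ b, P a b * h a b = 0) {K θ : ℝ}
    (hK : ∀ a b, |h a b| ≤ K) (hθ : 0 ≤ θ) (hθK : θ * K ≤ 1) (a : Fin 2) :
    ∑ b, P a b * Real.exp (θ * h a b) ≤ Real.exp ((θ * K) ^ 2) := by
  have hb : ∀ b, Real.exp (θ * h a b) ≤ 1 + θ * h a b + (θ * K) ^ 2 := by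
    intro b
    have h1 : |θ * h a b| ≤ θ * K := by
      rw [abs_mul, abs_of_nonneg hθ]
      exact mul_le_mul_of_nonneg_left (hK a b) hθ
    have h2 := (abs_le.1 (Real.abs_exp_sub_one_sub_id_le (h1.trans hθK))).2
    have h3 := sq_le_sq' (abs_le.1 h1).1 (abs_le.1 h1).2
    linarith
  calc ∑ b, P a b * Real.exp (θ * h a b)
      ≤ ∑ b, P a b * (1 + θ * h a b + (θ * K) ^ 2) :=
        Finset.sum_le_sum fun b _ => mul_le_mul_of_nonneg_left (hb b) (hP.nonneg a b)
    _ = (∑ b, P a b) * (1 + (θ * K) ^ 2) + θ * ∑ b, P a b * h a b := by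
        rw [Finset.sum_mul, Finset.mul_sum, ← Finset.sum_add_distrib]
        exact Finset.sum_congr rfl fun b _ => by ring
    _ ≤ Real.exp ((θ * K) ^ 2) := by
        rw [hP.sum_eq_one, hmean]
        linarith [Real.add_one_le_exp ((θ * K) ^ 2)]

/-- Chernoff bound and Borel–Cantelli: given the past, each summand has mean zero, so the bad events
have geometrically decaying probability. -/
theorem IsStochastic.ae_eventually_sum_lt {P : Fin 2 → Fin 2 → ℝ} (hP : IsStochastic P)
    {h : Fin 2 → Fin 2 → ℝ} (hmean : ∀ a, ∑ b, P a b * h a b = 0) {ε : ℝ} (hε : 0 < ε) :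
    ∀ᵐ ω ∂chainMeasure P, ∀ᶠ n : ℕ in atTop,
      ∑ k ∈ Finset.range n, h (parent ω k) (ω k) < ε * n := by
  obtain ⟨K, hεK, hK⟩ : ∃ K, ε ≤ K ∧ ∀ a b, |h a b| ≤ K := by
    refine ⟨ε + ∑ a, ∑ b, |h a b|, ?_, fun a b => ?_⟩
    · have : 0 ≤ ∑ a, ∑ b, |h a b| := by positivity
      linarith
    · have h1 : |h a b| ≤ ∑ b, |h a b| :=
        Finset.single_le_sum (f := fun b => |h a b|) (fun _ _ => abs_nonneg _)
          (Finset.mem_univ b)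
      have h2 : ∑ b, |h a b| ≤ ∑ a, ∑ b, |h a b| :=
        Finset.single_le_sum (f := fun a => ∑ b, |h a b|) (fun _ _ => by positivity)
          (Finset.mem_univ a)
      linarith
  have hK0 : 0 < K := hε.trans_le hεK
  -- This θ minimises θ²K² - θε. Because ε ≤ K, it satisfies θK ≤ 1/2.
  set θ : ℝ := ε / (2 * K ^ 2) with hθ
  have hθ0 : 0 < θ := by positivity
  have hθK : θ * K ≤ 1 := by
    have : θ * K = ε / (2 * K) := by
      rw [hθ]
      field_simp
    rw [this, div_le_one (by positivity)]
    linarith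
  have hrate : (θ * K) ^ 2 - θ * ε = -(ε ^ 2 / (4 * K ^ 2)) := by
    rw [hθ]
    field_simp
    ring
  set c := Real.exp (-(ε ^ 2 / (4 * K ^ 2))) with hc
  have hc1 : c < 1 := by
    rw [hc, Real.exp_lt_one_iff]
    have : 0 < ε ^ 2 / (4 * K ^ 2) := by positivity
    linarith
  have hle : ∀ n : ℕ, chainMeasure P
      {ω | ε * n ≤ ∑ k ∈ Finset.range n, h (parent ω k) (ω k)} ≤ ENNReal.ofReal (c ^ n) := by
    intro n
    refine (hP.chainMeasure_le_sum (n := n)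
      (g := fun ω => Real.exp (θ * (∑ k ∈ Finset.range n, h (parent ω k) (ω k) - ε * n)))
      (fun ω => (Real.exp_pos _).le) ?_ ?_).trans (ENNReal.ofReal_le_ofReal ?_)
    · intro ω ω' hag
      rw [Finset.sum_congr rfl fun k hk => ?_]
      rw [Finset.mem_range] at hk
      rw [parent_congr fun i hi => hag i (hi.trans hk), hag k hk]
    · intro ω hω
      have hω' : ε * n ≤ ∑ k ∈ Finset.range n, h (parent ω k) (ω k) := hω
      rw [Real.one_le_exp_iff]
      exact mul_nonneg hθ0.le (by linarith)
    · have hprod : ∀ w : Fin n → Fin 2, mass P (extend w) n *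
          Real.exp (θ * (∑ k ∈ Finset.range n, h (parent (extend w) k) (extend w k) - ε * n)) =
          (∏ k ∈ Finset.range n, P (parent (extend w) k) (extend w k) *
            Real.exp (θ * h (parent (extend w) k) (extend w k))) * Real.exp (-(θ * ε)) ^ n := by
        intro w
        rw [Finset.prod_mul_distrib, ← Real.exp_sum, ← Real.exp_nat_mul, mass, mul_assoc,
          ← Real.exp_add, ← Finset.mul_sum]
        congr 2
        ring
      rw [Finset.sum_congr rfl fun w _ => hprod w, ← Finset.sum_mul]
      calc _ ≤ Real.exp ((θ * K) ^ 2) ^ n * Real.exp (-(θ * ε)) ^ n := by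
            refine mul_le_mul_of_nonneg_right ?_ (by positivity)
            refine sum_words_prod_le (Real.exp_pos _).le
              (fun k ω => P (parent ω k) (ω k) * Real.exp (θ * h (parent ω k) (ω k)))
              (fun k ω => mul_nonneg (hP.nonneg _ _) (Real.exp_pos _).le)
              (fun k ω ω' hag => ?_) (fun k ω => ?_) n
            · rw [parent_congr fun i hi => hag i hi.le, hag k le_rfl]
            · simpa [parent_update] using
                hP.sum_mul_exp_le hmean hK hθ0.le hθK (parent ω k)
        _ = c ^ n := by
            rw [← mul_pow, ← Real.exp_add, ← sub_eq_add_neg, hrate]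
  have hsum : ∑' n : ℕ, chainMeasure P
      {ω | ε * n ≤ ∑ k ∈ Finset.range n, h (parent ω k) (ω k)} ≠ ⊤ := by
    refine ne_top_of_le_ne_top ?_ (ENNReal.tsum_le_tsum hle)
    rw [← ENNReal.ofReal_tsum_of_nonneg (fun n => by positivity)
      (summable_geometric_of_lt_one (Real.exp_pos _).le hc1)]
    exact ENNReal.ofReal_ne_top
  filter_upwards [ae_eventually_notMem hsum] with ω hω
  filter_upwards [hω] with n hn
  exact not_le.1 hn

theorem IsStochastic.ae_tendsto_zero {P : Fin 2 → Fin 2 → ℝ} (hP : IsStochastic P)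
    {h : Fin 2 → Fin 2 → ℝ} (hmean : ∀ a, ∑ b, P a b * h a b = 0) :
    ∀ᵐ ω ∂chainMeasure P, Tendsto (fun n : ℕ =>
      (∑ k ∈ Finset.range n, h (parent ω k) (ω k)) / n) atTop (𝓝 0) := by
  have hpos : ∀ m : ℕ, (0 : ℝ) < 1 / (m + 1) := fun m => Nat.one_div_pos_of_nat
  have h1 := ae_all_iff.2 fun m : ℕ => hP.ae_eventually_sum_lt hmean (hpos m)
  have h2 := ae_all_iff.2 fun m : ℕ => hP.ae_eventually_sum_lt (h := fun a b => -h a b)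
    (fun a => by simp [hmean]) (hpos m)
  filter_upwards [h1, h2] with ω hω1 hω2
  rw [Metric.tendsto_atTop']
  intro ε hε
  obtain ⟨m, hm⟩ := exists_nat_one_div_lt hε
  obtain ⟨N, hN⟩ := eventually_atTop.1 ((hω1 m).and (hω2 m))
  refine ⟨N, fun n hn => ?_⟩
  obtain ⟨h3, h4⟩ := hN n hn.le
  have hn0 : (0 : ℝ) < n := by exact_mod_cast (Nat.zero_le N).trans_lt hn
  rw [Finset.sum_neg_distrib] at h4
  rw [Real.dist_eq, sub_zero, abs_div, abs_of_pos hn0, div_lt_iff₀ hn0, abs_lt]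
  have : (1 / ((m : ℝ) + 1)) * n < ε * n := by gcongr
  constructor <;> linarith

/-- A sequence that changes little from `n / 2` to `n` grows sublinearly. -/
theorem tendsto_div_of_le_half_add {e r : ℕ → ℝ} (he : ∀ n, 0 ≤ e n)
    (hr : Tendsto (fun n : ℕ => r n / n) atTop (𝓝 0)) (h : ∀ n, e n ≤ e (n / 2) + r n) :
    Tendsto (fun n : ℕ => e n / n) atTop (𝓝 0) := by
  rw [Metric.tendsto_atTop']
  intro ε hε
  obtain ⟨N, hN⟩ := eventually_atTop.1 ((hr.eventually (gt_mem_nhds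
    (show (0 : ℝ) < ε / 4 by positivity))).and (eventually_gt_atTop 0))
  set C := ∑ k ∈ Finset.range N, e k with hC
  have hC0 : 0 ≤ C := Finset.sum_nonneg fun _ _ => he _
  -- For n ≥ N, halving turns the slope ε/2 into ε/4, and r n adds at most another ε/4; C absorbs
  -- the values below N.
  have hlin : ∀ n : ℕ, e n ≤ ε / 2 * n + C := by
    intro n
    induction n using Nat.strong_induction_on with
    | _ n ih =>
      rcases lt_or_ge n N with hn | hn
      · have := Finset.single_le_sum (f := e) (fun _ _ => he _) (Finset.mem_range.2 hn)
        have h2 : 0 ≤ ε / 2 * n := by positivity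
        linarith
      · obtain ⟨h1, h2⟩ := hN n hn
        have hn0 : (0 : ℝ) < n := by exact_mod_cast h2
        rw [div_lt_iff₀ hn0] at h1
        have h3 := ih (n / 2) (Nat.div_lt_self h2 one_lt_two)
        have h4 : ((n / 2 : ℕ) : ℝ) ≤ n / 2 := Nat.cast_div_le
        have h5 : ε / 2 * ((n / 2 : ℕ) : ℝ) ≤ ε / 2 * (n / 2) := by gcongr
        have h6 := h n
        linarith
  obtain ⟨m, hm⟩ := exists_nat_gt (2 * C / ε)
  refine ⟨m, fun n hn => ?_⟩
  have hmn : (m : ℝ) < n := by exact_mod_cast hn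
  have hn0 : (0 : ℝ) < n := (Nat.cast_nonneg m).trans_lt hmn
  rw [Real.dist_eq, sub_zero, abs_of_nonneg (div_nonneg (he n) hn0.le), div_lt_iff₀ hn0]
  have := hlin n
  rw [div_lt_iff₀ hε] at hm
  have h7 : (m : ℝ) * ε < n * ε := by gcongr
  linarith

/-- The frequency of the letter `1` under the chain measure. -/
noncomputable def freq (P : Fin 2 → Fin 2 → ℝ) : ℝ := 2 * P 0 1 / (2 + P 0 1 - P 1 1)

theorem IsStochastic.le_one {P : Fin 2 → Fin 2 → ℝ} (hP : IsStochastic P) (a b : Fin 2) :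
    P a b ≤ 1 := by
  rw [← hP.sum_eq_one a]
  exact Finset.single_le_sum (f := P a) (fun _ _ => hP.nonneg _ _) (Finset.mem_univ b)

/-- Counting ones up to n reduces, up to a sublinear error, to counting them up to n/2. The limit is
the fixed point of f = P 0 1 + (P 1 1 - P 0 1)·f/2, which is `freq P`; the deviation from n·f is
controlled by that at n/2 since |P 1 1 - P 0 1| ≤ 1. -/
theorem IsStochastic.ae_tendsto_freq {P : Fin 2 → Fin 2 → ℝ} (hP : IsStochastic P) :
    ∀ᵐ ω ∂chainMeasure P, Tendsto (fun n : ℕ =>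
      (∑ k ∈ Finset.range n, ((ω k : ℕ) : ℝ)) / n) atTop (𝓝 (freq P)) := by
  have hmean : ∀ a, ∑ b, P a b * (((b : ℕ) : ℝ) - P a 1) = 0 := by
    intro a
    have := hP.sum_eq_one a
    rw [Fin.sum_univ_two] at this ⊢
    simp only [Fin.val_zero, Fin.val_one, Nat.cast_zero, Nat.cast_one]
    linear_combination (-P a 1) * this
  filter_upwards [hP.ae_tendsto_zero hmean] with ω hω
  have hq1 := hP.le_one 1 1
  have hp1 := hP.le_one 0 1
  have hp0 := hP.nonneg 0 1
  have hq0 := hP.nonneg 1 1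
  have hden : 0 < 2 + P 0 1 - P 1 1 := by linarith
  have hf : freq P * (2 + P 0 1 - P 1 1) = 2 * P 0 1 := div_mul_cancel₀ _ hden.ne'
  have hf0 : 0 ≤ freq P := div_nonneg (by linarith) hden.le
  have hf1 : freq P ≤ 1 := by
    rw [freq, div_le_one hden]
    linarith
  set f := freq P with hfdef
  set A : ℕ → ℝ := fun n => ∑ k ∈ Finset.range n, ((ω k : ℕ) : ℝ) with hA
  set o : ℕ → ℝ := fun n => ∑ k ∈ Finset.range n, (((ω k : ℕ) : ℝ) - P (parent ω k) 1) with ho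
  have hrec : ∀ n, A n = o n + (n * P 0 1 + (P 1 1 - P 0 1) * A (n / 2)) := by
    intro n
    have := sum_parent (fun a => P a 1) ω n
    simp only [ho, hA, Finset.sum_sub_distrib]
    rw [this]
    ring
  have hhalf : ∀ n : ℕ, |((n / 2 : ℕ) : ℝ) - n / 2| ≤ 1 := by
    intro n
    have h1 : n / 2 * 2 ≤ n := Nat.div_mul_le_self n 2
    have h2 : n ≤ n / 2 * 2 + 1 := by omega
    have h1' : ((n / 2 : ℕ) : ℝ) * 2 ≤ n := by exact_mod_cast h1
    have h2' : (n : ℝ) ≤ ((n / 2 : ℕ) : ℝ) * 2 + 1 := by exact_mod_cast h2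
    rw [abs_le]
    constructor <;> linarith
  have hstep : ∀ n : ℕ, |A n - n * f| ≤ |A (n / 2) - (n / 2 : ℕ) * f| + (|o n| + 1) := by
    intro n
    have e1 : A n - n * f = o n + (P 1 1 - P 0 1) * (A (n / 2) - (n / 2 : ℕ) * f) +
        (P 1 1 - P 0 1) * f * (((n / 2 : ℕ) : ℝ) - n / 2) := by
      rw [hrec]
      linear_combination (-(n : ℝ) / 2) * hf
    have hd : |P 1 1 - P 0 1| ≤ 1 := by
      rw [abs_le]
      constructor <;> linarith
    rw [e1]
    refine (abs_add_le _ _).trans ((add_le_add_left (abs_add_le _ _) _).trans ?_)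
    rw [abs_mul, abs_mul, abs_mul, abs_of_nonneg hf0]
    have h1 : |P 1 1 - P 0 1| * |A (n / 2) - (n / 2 : ℕ) * f| ≤
        |A (n / 2) - (n / 2 : ℕ) * f| := mul_le_of_le_one_left (abs_nonneg _) hd
    have h2 : |P 1 1 - P 0 1| * f * |((n / 2 : ℕ) : ℝ) - n / 2| ≤ 1 :=
      mul_le_one₀ (mul_le_one₀ hd hf0 hf1) (abs_nonneg _) (hhalf n)
    linarith
  have hr : Tendsto (fun n : ℕ => (|o n| + 1) / n) atTop (𝓝 0) := by
    have h1 : Tendsto (fun n : ℕ => |o n / n| + 1 / (n : ℝ)) atTop (𝓝 (|0| + 0)) :=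
      hω.abs.add tendsto_one_div_atTop_nhds_zero_nat
    rw [abs_zero, add_zero] at h1
    refine h1.congr fun n => ?_
    rw [abs_div, Nat.abs_cast, add_div]
  have hlim := tendsto_div_of_le_half_add (fun n => abs_nonneg (A n - n * f)) hr hstep
  have hlim' : Tendsto (fun n : ℕ => (A n - n * f) / n) atTop (𝓝 0) := by
    rw [tendsto_zero_iff_abs_tendsto_zero]
    refine hlim.congr fun n => ?_
    simp [abs_div]
  have := hlim'.add_const f
  rw [zero_add] at this
  refine this.congr' ?_
  filter_upwards [eventually_gt_atTop 0] with n hn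
  have hn0 : (n : ℝ) ≠ 0 := by exact_mod_cast hn.ne'
  field_simp
  ring

/-- The law of large numbers for the chain measure. -/
theorem IsStochastic.ae_tendsto {P : Fin 2 → Fin 2 → ℝ} (hP : IsStochastic P)
    (h : Fin 2 → Fin 2 → ℝ) :
    ∀ᵐ ω ∂chainMeasure P, Tendsto (fun n : ℕ =>
      (∑ k ∈ Finset.range n, h (parent ω k) (ω k)) / n) atTop
      (𝓝 ((1 - freq P / 2) * ∑ b, P 0 b * h 0 b + freq P / 2 * ∑ b, P 1 b * h 1 b)) := by
  set F : Fin 2 → ℝ := fun a => ∑ b, P a b * h a b with hF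
  have hmean : ∀ a, ∑ b, P a b * (h a b - F a) = 0 := by
    intro a
    simp only [mul_sub, Finset.sum_sub_distrib, ← Finset.sum_mul, hP.sum_eq_one]
    simp [hF]
  filter_upwards [hP.ae_tendsto_zero hmean, hP.ae_tendsto_freq] with ω hω1 hω2
  have hdiv : Tendsto (fun n : ℕ => n / 2) atTop atTop := Nat.tendsto_div_const_atTop two_ne_zero
  have hratio : Tendsto (fun n : ℕ => ((n / 2 : ℕ) : ℝ) / n) atTop (𝓝 (1 / 2)) := by
    have := (tendsto_nat_floor_mul_div_atTop (R := ℝ) (a := 1 / 2) (by norm_num)).comp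
      tendsto_natCast_atTop_atTop
    refine this.congr fun n => ?_
    simp only [Function.comp_apply]
    congr 2
    rw [one_div_mul_eq_div, ← Nat.floor_div_eq_div (K := ℝ)]
    norm_num
  -- The parents equal to 1 are the ones among the first n/2 letters, so their proportion among n
  -- indices tends to `freq P / 2`.
  have hA := (hω2.comp hdiv).mul hratio
  have hlim := hω1.add ((hA.const_mul (F 1 - F 0)).add_const (F 0))
  have hval : 0 + ((F 1 - F 0) * (freq P * (1 / 2)) + F 0) =
      (1 - freq P / 2) * F 0 + freq P / 2 * F 1 := by ring
  rw [hval] at hlim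
  refine hlim.congr' ?_
  filter_upwards [eventually_gt_atTop 1] with n hn
  have hn0 : (n : ℝ) ≠ 0 := by exact_mod_cast (by omega : n ≠ 0)
  have hn2 : ((n / 2 : ℕ) : ℝ) ≠ 0 := by exact_mod_cast (by omega : n / 2 ≠ 0)
  simp only [Function.comp_apply, Finset.sum_sub_distrib, sum_parent F ω n]
  field_simp
  ring

/-! ### Stopped words of a given interval length -/

section Stopping

variable {l₀ l₁ : ℝ}

theorem exists_exp_neg_expoSum_le (h₀ : 0 < l₀) (h₁ : 0 < l₁) {r : ℝ} (hr : 0 < r) :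
    ∃ M : ℕ, ∀ ω, Real.exp (-expoSum l₀ l₁ ω M) ≤ r := by
  have hmin : 0 < min l₀ l₁ := lt_min h₀ h₁
  obtain ⟨M, hM⟩ := exists_nat_gt (-Real.log r / min l₀ l₁)
  rw [div_lt_iff₀ hmin] at hM
  refine ⟨M, fun ω => ?_⟩
  rw [← Real.le_log_iff_exp_le hr]
  linarith [mul_min_le_expoSum l₀ l₁ ω M]

open Classical in
/-- The first `n` at which the basic interval of level `n` around `ω` has length at most `r`. -/
noncomputable def stopLen (l₀ l₁ r : ℝ) (ω : Seq) : ℕ :=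
  if h : ∃ n, Real.exp (-expoSum l₀ l₁ ω n) ≤ r then Nat.find h else 0

theorem exp_neg_expoSum_stop_le (h₀ : 0 < l₀) (h₁ : 0 < l₁) {r : ℝ} (hr : 0 < r) (ω : Seq) :
    Real.exp (-expoSum l₀ l₁ ω (stopLen l₀ l₁ r ω)) ≤ r := by
  classical
  have h : ∃ n, Real.exp (-expoSum l₀ l₁ ω n) ≤ r :=
    (exists_exp_neg_expoSum_le h₀ h₁ hr).imp fun _ hM => hM ω
  rw [stopLen, dif_pos h]
  exact Nat.find_spec h

theorem stop_le {r : ℝ} {ω : Seq} {n : ℕ} (hn : Real.exp (-expoSum l₀ l₁ ω n) ≤ r) :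
    stopLen l₀ l₁ r ω ≤ n := by
  classical
  rw [stopLen, dif_pos ⟨n, hn⟩]
  exact Nat.find_min' _ hn

theorem lt_exp_neg_expoSum_stop {r : ℝ} (ω : Seq) (h : stopLen l₀ l₁ r ω ≠ 0) :
    r * Real.exp (-max l₀ l₁) < Real.exp (-expoSum l₀ l₁ ω (stopLen l₀ l₁ r ω)) := by
  obtain ⟨m, hm⟩ := Nat.exists_eq_succ_of_ne_zero h
  have h1 : r < Real.exp (-expoSum l₀ l₁ ω m) := by
    by_contra! h2
    have := stop_le h2
    omega
  rw [hm, Nat.succ_eq_add_one, expoSum_succ, neg_add, Real.exp_add]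
  have h2 : Real.exp (-max l₀ l₁) ≤ Real.exp (-expo l₀ l₁ (ω m)) :=
    Real.exp_le_exp.2 (neg_le_neg (expo_le_max _ _ _))
  calc r * Real.exp (-max l₀ l₁) < Real.exp (-expoSum l₀ l₁ ω m) * Real.exp (-max l₀ l₁) := by
        gcongr
    _ ≤ _ := by gcongr

/-- Whether to stop at n depends only on the first n letters, so no stopped word is a proper prefix
of another. -/
theorem stop_eq_of_agree (h₀ : 0 < l₀) (h₁ : 0 < l₁) {r : ℝ} (hr : 0 < r) {ω ω' : Seq}
    (h : ∀ i < min (stopLen l₀ l₁ r ω) (stopLen l₀ l₁ r ω'), ω i = ω' i) :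
    stopLen l₀ l₁ r ω = stopLen l₀ l₁ r ω' := by
  rcases le_total (stopLen l₀ l₁ r ω) (stopLen l₀ l₁ r ω') with hle | hle
  · refine le_antisymm hle (stop_le ?_)
    rw [← expoSum_congr l₀ l₁ fun i hi => h i (by rwa [min_eq_left hle])]
    exact exp_neg_expoSum_stop_le h₀ h₁ hr ω
  · refine le_antisymm (stop_le ?_) hle
    rw [expoSum_congr l₀ l₁ fun i hi => h i (by rwa [min_eq_right hle])]
    exact exp_neg_expoSum_stop_le h₀ h₁ hr ω'

/-- The stopped word of `ω`, with its length. -/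
noncomputable def stopWord (l₀ l₁ r : ℝ) (ω : Seq) : ℕ × Seq :=
  (stopLen l₀ l₁ r ω, extend fun i : Fin (stopLen l₀ l₁ r ω) => ω i)

theorem stopWord_eq_of_agree (h₀ : 0 < l₀) (h₁ : 0 < l₁) {r : ℝ} (hr : 0 < r) {ω ω' : Seq}
    (h : ∀ i < min (stopLen l₀ l₁ r ω) (stopLen l₀ l₁ r ω'), ω i = ω' i) :
    stopWord l₀ l₁ r ω = stopWord l₀ l₁ r ω' := by
  have hs := stop_eq_of_agree h₀ h₁ hr h
  refine Prod.ext hs ?_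
  funext k
  simp only [stopWord, extend]
  rw [hs, min_self] at h
  rw [hs]
  split_ifs with hk
  · exact h k hk
  · rfl

theorem agree_of_stopWord_eq {r : ℝ} {ω ω' : Seq}
    (h : stopWord l₀ l₁ r ω = stopWord l₀ l₁ r ω') : ω' ∈ cylinder ω (stopLen l₀ l₁ r ω) := by
  intro i hi
  have h1 : stopLen l₀ l₁ r ω = stopLen l₀ l₁ r ω' := congrArg Prod.fst h
  have h2 := congrFun (congrArg Prod.snd h) i
  simp only [stopWord] at h2
  rw [extend_restrict _ _ hi, extend_restrict _ _ (h1 ▸ hi)] at h2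
  exact h2.symm

/-- The interior of the basic interval of the stopped word of `ω`. -/
def stopInterval (l₀ l₁ r : ℝ) (ω : Seq) : Set ℝ :=
  Set.Ioo (compFirst l₀ l₁ ω (stopLen l₀ l₁ r ω) 0) (compFirst l₀ l₁ ω (stopLen l₀ l₁ r ω) 1)

theorem disjoint_stopInterval (h₀ : 0 < l₀) (h₁ : 0 < l₁)
    (hosc : Real.exp (-l₀) + Real.exp (-l₁) ≤ 1) {r : ℝ} (hr : 0 < r) {ω ω' : Seq}
    (h : stopWord l₀ l₁ r ω ≠ stopWord l₀ l₁ r ω') :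
    Disjoint (stopInterval l₀ l₁ r ω) (stopInterval l₀ l₁ r ω') := by
  classical
  have hex : ∃ k, k < min (stopLen l₀ l₁ r ω) (stopLen l₀ l₁ r ω') ∧ ω k ≠ ω' k := by
    by_contra! hcon
    exact h (stopWord_eq_of_agree h₀ h₁ hr hcon)
  obtain ⟨hk, hne⟩ := Nat.find_spec hex
  have hmin : ∀ i < Nat.find hex, ω i = ω' i := by
    intro i hi
    by_contra hi'
    exact Nat.find_min hex hi ⟨hi.trans hk, hi'⟩
  have hk1 := hk.trans_le (min_le_left _ _)
  have hk2 := hk.trans_le (min_le_right _ _)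
  rw [Set.disjoint_left]
  rintro x ⟨hx1, hx2⟩ ⟨hx3, hx4⟩
  have hcases : ∀ a b : Fin 2, a ≠ b → (a = 0 ∧ b = 1) ∨ (b = 0 ∧ a = 1) := by decide
  rcases hcases _ _ hne with ⟨e1, e2⟩ | ⟨e1, e2⟩
  · have := compFirst_one_le_compFirst_zero h₀ h₁ hosc hmin e1 e2 hk1 hk2
    linarith
  · have := compFirst_one_le_compFirst_zero h₀ h₁ hosc (fun i hi => (hmin i hi).symm) e1 e2 hk2 hk1
    linarith

/-- A set of diameter at most `r` meets boundedly many basic intervals of length about `r`. -/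
theorem card_le_of_stopWord_injOn (h₀ : 0 < l₀) (h₁ : 0 < l₁)
    (hosc : Real.exp (-l₀) + Real.exp (-l₁) ≤ 1) {r : ℝ} (hr : 0 < r) (hr1 : r < 1)
    (T : Finset Seq) (hinj : Set.InjOn (stopWord l₀ l₁ r) T)
    (hdiam : ∀ ω ∈ T, ∀ ω' ∈ T, |proj l₀ l₁ ω - proj l₀ l₁ ω'| ≤ r) :
    (T.card : ℝ) ≤ 4 * Real.exp (max l₀ l₁) := by
  rcases T.eq_empty_or_nonempty with rfl | ⟨ω₀, hω₀⟩
  · simp only [Finset.card_empty, Nat.cast_zero]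
    positivity
  have hlen : ∀ ω, compFirst l₀ l₁ ω (stopLen l₀ l₁ r ω) 1 =
      compFirst l₀ l₁ ω (stopLen l₀ l₁ r ω) 0 +
      Real.exp (-expoSum l₀ l₁ ω (stopLen l₀ l₁ r ω)) := fun ω => by
    rw [compFirst_eq l₀ l₁ ω _ 1, mul_one]
  -- The empty word has an interval of length 1 > r, so stopping never occurs at 0 and the lower
  -- bound on the stopped length applies.
  have hpos_len : ∀ ω, stopLen l₀ l₁ r ω ≠ 0 := by
    intro ω h
    have := exp_neg_expoSum_stop_le h₀ h₁ hr ω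
    rw [h] at this
    simp [expoSum] at this
    linarith
  -- The intervals are disjoint, longer than r·exp(-max) and contained in an interval of length 4r;
  -- comparing lengths gives the constant.
  have hsub : (⋃ ω ∈ T, stopInterval l₀ l₁ r ω) ⊆
      Set.Icc (proj l₀ l₁ ω₀ - 2 * r) (proj l₀ l₁ ω₀ + 2 * r) := by
    intro x hx
    simp only [Set.mem_iUnion] at hx
    obtain ⟨ω, hω, hx1, hx2⟩ := hx
    have h3 := proj_mem_Icc h₀ h₁ ω (stopLen l₀ l₁ r ω)
    have h4 := exp_neg_expoSum_stop_le h₀ h₁ hr ω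
    have h5 := abs_le.1 (hdiam ω hω ω₀ hω₀)
    rw [hlen] at h3 hx2
    constructor <;> linarith [h3.1, h3.2, h5.1, h5.2]
  have hvol := measure_mono (μ := volume) hsub
  rw [measure_biUnion_finset (fun ω hω ω' hω' hne => disjoint_stopInterval h₀ h₁ hosc hr
    fun h => hne (hinj hω hω' h)) (fun ω _ => measurableSet_Ioo), Real.volume_Icc] at hvol
  have hlow : ∑ ω ∈ T, ENNReal.ofReal (r * Real.exp (-max l₀ l₁)) ≤
      ∑ ω ∈ T, volume (stopInterval l₀ l₁ r ω) := by
    refine Finset.sum_le_sum fun ω _ => ?_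
    rw [stopInterval, Real.volume_Ioo, hlen]
    apply ENNReal.ofReal_le_ofReal
    linarith [lt_exp_neg_expoSum_stop (l₀ := l₀) (l₁ := l₁) ω (hpos_len ω)]
  have hfin := hlow.trans hvol
  rw [← ENNReal.ofReal_sum_of_nonneg (fun _ _ => by positivity),
    ENNReal.ofReal_le_ofReal_iff (by linarith), Finset.sum_const, nsmul_eq_mul] at hfin
  have h5 : (T.card : ℝ) * Real.exp (-max l₀ l₁) ≤ 4 := by
    refine le_of_mul_le_mul_right ?_ hr
    linarith
  rw [Real.exp_neg, ← div_eq_mul_inv, div_le_iff₀ (Real.exp_pos _)] at h5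
  exact h5

theorem finite_range_stopWord (h₀ : 0 < l₀) (h₁ : 0 < l₁) {r : ℝ} (hr : 0 < r) :
    (Set.range (stopWord l₀ l₁ r)).Finite := by
  obtain ⟨M, hM⟩ := exists_exp_neg_expoSum_le h₀ h₁ hr
  refine Set.Finite.subset (s := ⋃ n ∈ Finset.range (M + 1),
    Set.range fun w : Fin n → Fin 2 => (n, extend w)) ?_ ?_
  · exact Set.Finite.biUnion (Finset.finite_toSet _) fun n _ => Set.finite_range _
  · rintro _ ⟨ω, rfl⟩
    simp only [Set.mem_iUnion]
    exact ⟨stopLen l₀ l₁ r ω, Finset.mem_range.2 (Nat.lt_succ_of_le (stop_le (hM ω))), _, rfl⟩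

/-- F is covered by the cylinders of its stopped words. There are boundedly many, and each has mass
at most r^d. -/
theorem chainMeasure_le_rpow (h₀ : 0 < l₀) (h₁ : 0 < l₁)
    (hosc : Real.exp (-l₀) + Real.exp (-l₁) ≤ 1) {P : Fin 2 → Fin 2 → ℝ} (hP : IsStochastic P)
    {d r : ℝ} (hd : 0 ≤ d) (hr : 0 < r) {N : ℕ} (hrN : r < Real.exp (-(N * max l₀ l₁)))
    {F : Set Seq} (hmass : ∀ ω ∈ F, ∀ n ≥ N, mass P ω n ≤ Real.exp (-(d * expoSum l₀ l₁ ω n)))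
    (hdiam : ∀ ω ∈ F, ∀ ω' ∈ F, |proj l₀ l₁ ω - proj l₀ l₁ ω'| ≤ r) :
    chainMeasure P F ≤ ENNReal.ofReal (4 * Real.exp (max l₀ l₁) * r ^ d) := by
  have hmax : 0 < max l₀ l₁ := lt_max_of_lt_left h₀
  have hr1 : r < 1 := by
    refine hrN.trans_le (Real.exp_le_one_iff.2 ?_)
    have : 0 ≤ (N : ℝ) * max l₀ l₁ := by positivity
    linarith
  -- One representative in F for each stopped word, so that `hmass` and `hdiam` apply to it.
  obtain ⟨t, htF, hbij⟩ := Set.exists_subset_bijOn F (stopWord l₀ l₁ r)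
  have htfin : t.Finite := by
    refine Set.Finite.of_finite_image (f := stopWord l₀ l₁ r) ?_ hbij.injOn
    exact (finite_range_stopWord h₀ h₁ hr).subset (Set.image_subset_range _ _)
  set T := htfin.toFinset with hT
  have hTF : ∀ ω ∈ T, ω ∈ F := fun ω hω => htF (htfin.mem_toFinset.1 hω)
  have hcard := card_le_of_stopWord_injOn h₀ h₁ hosc hr hr1 T
    (by rw [hT, htfin.coe_toFinset]; exact hbij.injOn)
    (fun ω hω ω' hω' => hdiam ω (hTF ω hω) ω' (hTF ω' hω'))
  have hcov : F ⊆ ⋃ ω ∈ T, cylinder ω (stopLen l₀ l₁ r ω) := by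
    intro ω hω
    obtain ⟨ω₀, hω₀, he⟩ := hbij.surjOn (Set.mem_image_of_mem _ hω)
    simp only [Set.mem_iUnion]
    exact ⟨ω₀, htfin.mem_toFinset.2 hω₀, agree_of_stopWord_eq he⟩
  have hone : ∀ ω ∈ T, chainMeasure P (cylinder ω (stopLen l₀ l₁ r ω)) ≤ ENNReal.ofReal (r ^ d) := by
    intro ω hω
    rw [hP.chainMeasure_cylinder]
    apply ENNReal.ofReal_le_ofReal
    have hle := exp_neg_expoSum_stop_le h₀ h₁ hr ω
    -- By `hrN`, words of length below N still have intervals longer than r.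
    have hN : N ≤ stopLen l₀ l₁ r ω := by
      have h1 := Real.exp_lt_exp.1 (hle.trans_lt hrN)
      have h2 := expoSum_le_mul_max l₀ l₁ ω (stopLen l₀ l₁ r ω)
      have h3 : (N : ℝ) * max l₀ l₁ < stopLen l₀ l₁ r ω * max l₀ l₁ := by linarith
      exact_mod_cast (lt_of_mul_lt_mul_right h3 hmax.le).le
    refine (hmass ω (hTF ω hω) _ hN).trans ?_
    calc Real.exp (-(d * expoSum l₀ l₁ ω (stopLen l₀ l₁ r ω)))
        = Real.exp (-expoSum l₀ l₁ ω (stopLen l₀ l₁ r ω)) ^ d := by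
          rw [← Real.exp_mul]
          ring_nf
      _ ≤ r ^ d := Real.rpow_le_rpow (Real.exp_pos _).le hle hd
  calc chainMeasure P F ≤ ∑ ω ∈ T, chainMeasure P (cylinder ω (stopLen l₀ l₁ r ω)) :=
        (measure_mono hcov).trans (measure_biUnion_finset_le _ _)
    _ ≤ ∑ ω ∈ T, ENNReal.ofReal (r ^ d) := Finset.sum_le_sum hone
    _ = ENNReal.ofReal (T.card * r ^ d) := by
        rw [Finset.sum_const, nsmul_eq_mul, ENNReal.ofReal_mul (by positivity),
          ENNReal.ofReal_natCast]
    _ ≤ _ := by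
        apply ENNReal.ofReal_le_ofReal
        gcongr

end Stopping

/-! ### Lower bound for sets of full measure -/

/-- A mass distribution principle for projections of sets of full chain measure. -/
theorem IsStochastic.le_dimH_proj {l₀ l₁ : ℝ} (h₀ : 0 < l₀) (h₁ : 0 < l₁)
    (hosc : Real.exp (-l₀) + Real.exp (-l₁) ≤ 1) {P : Fin 2 → Fin 2 → ℝ} (hP : IsStochastic P)
    {d : ℝ} {E : Set Seq} (hE : ∀ᵐ ω ∂chainMeasure P, ω ∈ E)
    (hmass : ∀ᵐ ω ∂chainMeasure P, ∀ᶠ n in atTop,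
      mass P ω n ≤ Real.exp (-(d * expoSum l₀ l₁ ω n))) :
    ENNReal.ofReal d ≤ dimH (proj l₀ l₁ '' E) := by
  refine le_of_forall_lt fun d' hd' => ?_
  obtain ⟨d'', hd1, hd2⟩ := ENNReal.lt_iff_exists_nnreal_btwn.1 hd'
  refine hd1.trans_le (le_dimH_of_hausdorffMeasure_ne_zero ?_)
  rcases eq_or_ne d'' 0 with rfl | hne
  · exact absurd hd1 (by simp)
  have hd0 : (0 : ℝ) < d'' := by
    exact_mod_cast pos_iff_ne_zero.2 hne
  have hdd : (d'' : ℝ) < d := by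
    rwa [ENNReal.lt_ofReal_iff_toReal_lt ENNReal.coe_ne_top, ENNReal.coe_toReal] at hd2
  have hprob := hP.isProbabilityMeasure
  -- The mass estimate holds eventually, with a threshold depending on ω. Restricting to a set of
  -- positive outer measure makes the threshold uniform.
  set EN : ℕ → Set Seq := fun N =>
    {ω | ω ∈ E ∧ ∀ n ≥ N, mass P ω n ≤ Real.exp (-(d * expoSum l₀ l₁ ω n))} with hEN
  have hN : ∃ N, chainMeasure P (EN N) ≠ 0 := by
    by_contra! hcon
    have hnull : chainMeasure P (⋃ N, EN N) = 0 := measure_iUnion_null hcon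
    have : ∀ᵐ ω ∂chainMeasure P, ω ∈ ⋃ N, EN N := by
      filter_upwards [hE, hmass] with ω h1 h2
      obtain ⟨N, hN⟩ := eventually_atTop.1 h2
      exact Set.mem_iUnion.2 ⟨N, h1, hN⟩
    have hfalse : ∀ᵐ ω ∂chainMeasure P, False := by
      filter_upwards [this, measure_eq_zero_iff_ae_notMem.1 hnull] with ω h1 h2
      exact h2 h1
    simp at hfalse
    exact hprob.ne_zero _ hfalse
  obtain ⟨N, hN⟩ := hN
  have hπ := measurable_proj h₀ h₁
  set μ := ((chainMeasure P).restrict (EN N)).map (proj l₀ l₁) with hμ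
  set K := 4 * Real.exp (max l₀ l₁) with hK
  have hK0 : 0 < K := by positivity
  -- Lowering the exponent from d to d'' absorbs the constant K for small r.
  have hsmall : ∀ᶠ r : ℝ in 𝓝[>] 0, K * r ^ (d - d'' : ℝ) ≤ 1 ∧
      r < Real.exp (-(N * max l₀ l₁)) := by
    have h1 : Tendsto (fun r : ℝ => K * r ^ (d - d'' : ℝ)) (𝓝[>] 0) (𝓝 (K * 0 ^ (d - d'' : ℝ))) :=
      ((Real.continuousAt_rpow_const 0 _ (Or.inr (by linarith))).tendsto.mono_left
        nhdsWithin_le_nhds).const_mul K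
    rw [Real.zero_rpow (by linarith), mul_zero] at h1
    have h2 : ∀ᶠ r : ℝ in 𝓝[>] 0, r < Real.exp (-(N * max l₀ l₁)) :=
      (gt_mem_nhds (Real.exp_pos _)).filter_mono nhdsWithin_le_nhds
    filter_upwards [h1.eventually (gt_mem_nhds zero_lt_one), h2] with r hr1 hr2
    exact ⟨hr1.le, hr2⟩
  obtain ⟨r₁, hr₁, hr₁'⟩ := mem_nhdsGT_iff_exists_Ioo_subset.1 hsmall
  have hr₁0 : 0 < r₁ := hr₁
  have hB : ∀ B : Set ℝ, ∀ r : ℝ, 0 < r → r < r₁ → Metric.ediam B ≤ ENNReal.ofReal r →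
      μ B ≤ ENNReal.ofReal (r ^ (d'' : ℝ)) := by
    intro B r hr hrr₁ hBr
    obtain ⟨hKr, hrN⟩ := hr₁' ⟨hr, hrr₁⟩
    -- The closure is measurable and has the same diameter.
    have hcl : MeasurableSet (closure B) := isClosed_closure.measurableSet
    refine (measure_mono subset_closure).trans ?_
    rw [hμ, Measure.map_apply hπ hcl, Measure.restrict_apply (hπ hcl)]
    refine (chainMeasure_le_rpow h₀ h₁ hosc hP (hd0.trans hdd).le hr hrN
      (fun ω hω => hω.2.2) fun ω hω ω' hω' => ?_).trans (ENNReal.ofReal_le_ofReal ?_)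
    · have := Metric.edist_le_ediam_of_mem (Set.mem_preimage.1 hω.1) (Set.mem_preimage.1 hω'.1)
      rw [Metric.ediam_closure] at this
      rw [← Real.dist_eq]
      rw [edist_dist] at this
      exact (ENNReal.ofReal_le_ofReal_iff hr.le).1 (this.trans hBr)
    · have h2 : r ^ d = r ^ (d - d'' : ℝ) * r ^ (d'' : ℝ) := by
        rw [← Real.rpow_add hr]
        ring_nf
      rw [← hK, h2, ← mul_assoc]
      exact mul_le_of_le_one_left (by positivity) hKr
  have hle : μ ≤ Measure.hausdorffMeasure d'' := by
    refine Measure.le_hausdorffMeasure _ _ (ENNReal.ofReal (r₁ / 2))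
      (ENNReal.ofReal_pos.2 (by positivity)) fun B hBr => ?_
    have hBtop : Metric.ediam B ≠ ⊤ := ne_top_of_le_ne_top ENNReal.ofReal_ne_top hBr
    -- Sets of diameter zero are treated by letting r tend to 0.
    rcases eq_or_ne (Metric.ediam B) 0 with h0 | h0
    · rw [h0, ENNReal.zero_rpow_of_pos hd0]
      have hlim : Tendsto (fun r : ℝ => ENNReal.ofReal (r ^ (d'' : ℝ))) (𝓝[>] 0) (𝓝 0) := by
        have h1 : Tendsto (fun r : ℝ => r ^ (d'' : ℝ)) (𝓝[>] 0) (𝓝 (0 ^ (d'' : ℝ))) :=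
          (Real.continuousAt_rpow_const 0 _ (Or.inr hd0.le)).tendsto.mono_left
            nhdsWithin_le_nhds
        rw [Real.zero_rpow hd0.ne'] at h1
        simpa using ENNReal.tendsto_ofReal h1
      refine ge_of_tendsto hlim ?_
      filter_upwards [Ioo_mem_nhdsGT hr₁0] with r hr
      exact hB B r hr.1 hr.2 (by rw [h0]; exact zero_le)
    · have hpos : 0 < (Metric.ediam B).toReal := ENNReal.toReal_pos h0 hBtop
      have hlt : (Metric.ediam B).toReal < r₁ := by
        have := ENNReal.toReal_le_of_le_ofReal (by positivity) hBr
        linarith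
      refine (hB B _ hpos hlt (ENNReal.ofReal_toReal hBtop).ge).trans_eq ?_
      rw [← ENNReal.ofReal_rpow_of_pos hpos, ENNReal.ofReal_toReal hBtop]
  intro hzero
  apply hN
  have h1 : μ (proj l₀ l₁ '' E) = 0 := le_antisymm ((hle _).trans hzero.le) zero_le
  -- Only the inequality for the image measure is used, since the projection of E need not be
  -- measurable.
  have h2 : (chainMeasure P).restrict (EN N) (proj l₀ l₁ ⁻¹' (proj l₀ l₁ '' E)) = 0 :=
    le_antisymm ((Measure.le_map_apply hπ.aemeasurable _).trans h1.le) zero_le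
  have hsub : EN N ⊆ proj l₀ l₁ ⁻¹' (proj l₀ l₁ '' E) := fun ω hω =>
    Set.mem_image_of_mem (proj l₀ l₁) hω.1
  have h3 := measure_mono_null hsub h2
  rwa [Measure.restrict_apply_self] at h3

/-- The limit of the averages of `h (parent ω k) (ω k)` under the chain measure. -/
noncomputable def chainAvg (P h : Fin 2 → Fin 2 → ℝ) : ℝ :=
  (1 - freq P / 2) * ∑ b, P 0 b * h 0 b + freq P / 2 * ∑ b, P 1 b * h 1 b

/-- The ratio of entropy and Lyapunov exponent of the chain measure bounds the dimension of sets
of full measure from below. -/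
theorem IsStochastic.le_dimH_of_entropy {l₀ l₁ : ℝ} (h₀ : 0 < l₀) (h₁ : 0 < l₁)
    (hosc : Real.exp (-l₀) + Real.exp (-l₁) ≤ 1) {P : Fin 2 → Fin 2 → ℝ} (hP : IsStochastic P)
    {s : ℝ} (hpos : 0 < chainAvg P fun _ b => expo l₀ l₁ b)
    (hs : chainAvg P (fun a b => Real.log (P a b)) = -s * chainAvg P fun _ b => expo l₀ l₁ b)
    {E : Set Seq} (hE : ∀ᵐ ω ∂chainMeasure P, ω ∈ E) :
    ENNReal.ofReal s ≤ dimH (proj l₀ l₁ '' E) := by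
  refine le_of_forall_lt_imp_le_of_dense fun d' hd' => ?_
  have hd'top : d' ≠ ⊤ := (hd'.trans ENNReal.ofReal_lt_top).ne
  have hds : d'.toReal < s := (ENNReal.lt_ofReal_iff_toReal_lt hd'top).1 hd'
  rw [← ENNReal.ofReal_toReal hd'top]
  refine hP.le_dimH_proj h₀ h₁ hosc hE ?_
  filter_upwards [hP.ae_tendsto fun a b => Real.log (P a b),
    hP.ae_tendsto fun _ b => expo l₀ l₁ b] with ω hω1 hω2
  set d := d'.toReal
  have hlim := hω1.add (hω2.const_mul d)
  have hneg : chainAvg P (fun a b => Real.log (P a b)) +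
      d * chainAvg P (fun _ b => expo l₀ l₁ b) < 0 := by
    rw [hs]
    nlinarith
  filter_upwards [hlim.eventually (gt_mem_nhds hneg), eventually_gt_atTop 0] with n hn hn0
  have hn1 : (0 : ℝ) < n := by exact_mod_cast hn0
  -- Entries of P may vanish. Cylinders of mass 0 satisfy the bound trivially; in the averages
  -- `Real.log 0 = 0` realises the convention 0·log 0 = 0.
  rcases (mass_nonneg hP.nonneg ω n).eq_or_lt' with hm | hm
  · rw [hm]
    positivity
  · rw [← Real.log_le_iff_le_exp hm, mass, Real.log_prod fun k hk => ?_]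
    · rw [← mul_div_assoc, ← add_div, div_lt_iff₀ hn1, zero_mul] at hn
      unfold expoSum
      linarith
    · intro h0
      exact hm.ne' (Finset.prod_eq_zero hk h0)

theorem sum_parent_mul (ω : Seq) (n : ℕ) :
    ∑ k ∈ Finset.range (2 * n), ((parent ω k : ℕ) : ℝ) * ((ω k : ℕ) : ℝ) = pairSum ω n := by
  induction n with
  | zero => simp [pairSum]
  | succ n ih =>
    have h1 : parent ω (2 * n) = 0 := by simp [parent]
    have h2 : parent ω (2 * n + 1) = ω n := by
      have : (2 * n + 1) / 2 = n := by omega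
      simp [parent, this]
    rw [show 2 * (n + 1) = 2 * n + 1 + 1 by ring, Finset.sum_range_succ, Finset.sum_range_succ,
      ih, h1, h2, pairSum, pairSum, Finset.sum_range_succ]
    simp

/-- Pairs (parent, letter) up to index 2n correspond to the n products in `pairSum`; this doubling
cancels the 1/2 in the frequency of parents equal to 1. -/
theorem IsStochastic.ae_mem_setAlevel {P : Fin 2 → Fin 2 → ℝ} (hP : IsStochastic P) {α : ℝ}
    (hα : freq P * P 1 1 = α) : ∀ᵐ ω ∂chainMeasure P, ω ∈ setAlevel α := by
  filter_upwards [hP.ae_tendsto fun a b => ((a : ℕ) : ℝ) * ((b : ℕ) : ℝ)] with ω hω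
  rw [mem_setAlevel_iff]
  have h2 : Tendsto (fun n : ℕ => 2 * n) atTop atTop := tendsto_id.const_mul_atTop' two_pos
  have h3 := (hω.comp h2).const_mul 2
  have hval : 2 * ((1 - freq P / 2) * ∑ b : Fin 2, P 0 b * ((((0 : Fin 2) : ℕ) : ℝ) *
      ((b : ℕ) : ℝ)) + freq P / 2 * ∑ b : Fin 2, P 1 b * ((((1 : Fin 2) : ℕ) : ℝ) *
      ((b : ℕ) : ℝ))) = α := by
    simp [Fin.sum_univ_two, ← hα]
    ring
  rw [hval] at h3
  refine h3.congr fun n => ?_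
  simp only [Function.comp_apply, sum_parent_mul]
  push_cast
  rw [← mul_div_assoc]
  exact mul_div_mul_left _ _ two_ne_zero

theorem IsStochastic.ae_mem_setA {P : Fin 2 → Fin 2 → ℝ} (hP : IsStochastic P)
    (h11 : P 1 1 = 0) : ∀ᵐ ω ∂chainMeasure P, ω ∈ setA := by
  classical
  have hi : ∀ i : ℕ, ∀ᵐ ω ∂chainMeasure P, ¬ (ω i = 1 ∧ ω (2 * i + 1) = 1) := by
    intro i
    rw [ae_iff]
    simp only [not_not]
    refine le_antisymm ?_ zero_le
    refine (hP.chainMeasure_le_sum (n := 2 * i + 2)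
      (g := fun ω => if ω i = 1 ∧ ω (2 * i + 1) = 1 then 1 else 0) (fun ω => ?_) ?_ ?_).trans ?_
    · positivity
    · intro ω ω' h
      rw [h i (by omega), h (2 * i + 1) (by omega)]
    · intro ω hω
      exact (if_pos hω).ge
    · rw [Finset.sum_eq_zero, ENNReal.ofReal_zero]
      intro w _
      split_ifs with h
      · rw [mul_one]
        refine Finset.prod_eq_zero (Finset.mem_range.2 (by omega : 2 * i + 1 < 2 * i + 2)) ?_
        have h2 : parent (extend w) (2 * i + 1) = extend w i := by
          have : (2 * i + 1) / 2 = i := by omega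
          simp [parent, this]
        rw [h2, h.1, h.2, h11]
      · rw [mul_zero]
  filter_upwards [ae_all_iff.2 hi] with ω hω
  intro k hk
  obtain ⟨i, rfl⟩ : ∃ i, k = i + 1 := ⟨k - 1, by omega⟩
  have := hω i
  have e2 : 2 * (i + 1) - 1 = 2 * i + 1 := by omega
  simp only [letter, Nat.add_sub_cancel, e2]
  by_cases h : ω i = 0
  · simp [h]
  · by_cases h' : ω (2 * i + 1) = 0
    · simp [h']
    · exact absurd ⟨Fin.eq_one_of_ne_zero _ h, Fin.eq_one_of_ne_zero _ h'⟩ this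

theorem setL_subset_setLlevel_zero (l₀ l₁ : ℝ) : setL l₀ l₁ ⊆ setLlevel l₀ l₁ 0 := by
  refine Set.image_mono fun ω hω => ?_
  have h : ∀ n : ℕ, ∑ k ∈ Finset.Icc 1 n, (letter ω k : ℝ) * (letter ω (2 * k) : ℝ) = 0 :=
    fun n => Finset.sum_eq_zero fun k hk => by
      exact_mod_cast hω k (Finset.mem_Icc.1 hk).1
  simp [setAlevel, h]

/-! ### Equilibrium states and the system for (p, q) -/

/-- The transition matrix with probabilities `p` and `q` of the letter `1` after `0` and `1`. -/
def transition (p q : ℝ) : Fin 2 → Fin 2 → ℝ := ![![1 - p, p], ![1 - q, q]]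

theorem isStochastic_transition {p q : ℝ} (hp0 : 0 ≤ p) (hp1 : p ≤ 1) (hq0 : 0 ≤ q)
    (hq1 : q ≤ 1) : IsStochastic (transition p q) where
  nonneg a b := by
    fin_cases a <;> fin_cases b <;> simp [transition] <;> linarith
  sum_eq_one a := by
    fin_cases a <;> simp [transition]

theorem chainAvg_transition (p q : ℝ) (h : Fin 2 → Fin 2 → ℝ) :
    chainAvg (transition p q) h = (1 - p / (2 + p - q)) * ((1 - p) * h 0 0 + p * h 0 1) +
      p / (2 + p - q) * ((1 - q) * h 1 0 + q * h 1 1) := by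
  have : freq (transition p q) / 2 = p / (2 + p - q) := by
    simp only [freq, transition, Matrix.cons_val_zero, Matrix.cons_val_one]
    ring
  rw [chainAvg, this]
  simp [transition, Fin.sum_univ_two]

theorem chainAvg_transition_expo {p q : ℝ} (h : 2 + p - q ≠ 0) (l₀ l₁ : ℝ) :
    chainAvg (transition p q) (fun _ b => expo l₀ l₁ b) =
      ((2 - p - q) * l₀ + 2 * p * l₁) / (2 + p - q) := by
  rw [chainAvg_transition]
  simp only [expo, if_true, Fin.one_eq_zero_iff, OfNat.ofNat_ne_one, if_false]
  field_simp
  ring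

/-- The logarithmic form of the two equations: the transition probabilities are those of the
equilibrium state with parameters `s` and `t`. -/
structure IsGibbs (l₀ l₁ α p q s t v : ℝ) : Prop where
  p_pos : 0 < p
  p_lt : p < 1
  q_pos : 0 < q
  q_lt : q < 1
  -- The four logarithms have the form t·ab - s·λ_b + V(b)/2 - V(a) with V(0) = tα and V(1) = v.
  log_one_sub_p : Real.log (1 - p) = -s * l₀ - t * α / 2
  log_p : Real.log p = -s * l₁ + v / 2 - t * α
  log_one_sub_q : Real.log (1 - q) = -s * l₀ + t * α / 2 - v
  log_q : Real.log q = t - s * l₁ - v / 2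
  freq_eq : 2 * p * q = α * (2 + p - q)

theorem IsSolutionPQ.mem_Ioo {l₀ l₁ α p q : ℝ} (h : IsSolutionPQ l₀ l₁ α p q) :
    (0 < p ∧ p < 1) ∧ 0 < q ∧ q < 1 := by
  obtain ⟨⟨hp0, hp1⟩, ⟨hq0, hq1⟩, h1, h2, -, -⟩ := h
  refine ⟨⟨hp0.lt_of_ne ?_, hp1.lt_of_ne ?_⟩, hq0.lt_of_ne ?_, hq1.lt_of_ne ?_⟩ <;> rintro rfl <;>
    simp at h1 h2

theorem log_quotient {p q : ℝ} (hp0 : 0 < p) (hp1 : p < 1) (hq0 : 0 < q) (hq1 : q < 1) :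
    Real.log (p * (1 - q) / ((1 - p) * q)) =
      Real.log p + Real.log (1 - q) - (Real.log (1 - p) + Real.log q) := by
  have hp : 0 < 1 - p := by linarith
  have hq : 0 < 1 - q := by linarith
  rw [Real.log_div (by positivity) (by positivity), Real.log_mul hp0.ne' hq.ne',
    Real.log_mul hp.ne' hq0.ne']

theorem log_quotient_sq {p q : ℝ} (hp0 : 0 < p) (hp1 : p < 1) (hq1 : q < 1) :
    Real.log (p ^ 2 * (1 - q) / (1 - p)) =
      2 * Real.log p + Real.log (1 - q) - Real.log (1 - p) := by
  have hp : 0 < 1 - p := by linarith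
  have hq : 0 < 1 - q := by linarith
  rw [Real.log_div (by positivity) hp.ne', Real.log_mul (by positivity) hq.ne', Real.log_pow]
  norm_num

/-- The logarithmic equations are linear in s, t, v. Their combination log(1-p) + log q - log p -
log(1-q) forces t, and the equation for log q forces v; the rest is the dimension formula and the
first equation of the system. -/
theorem IsSolutionPQ.isGibbs {l₀ l₁ α p q s : ℝ} (h₀ : 0 < l₀) (h : IsSolutionPQ l₀ l₁ α p q)
    (hs : s = (α * Real.log (p * (1 - q) / ((1 - p) * q)) - 2 * Real.log (1 - p)) / (2 * l₀)) :
    ∃ t v, IsGibbs l₀ l₁ α p q s t v := by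
  obtain ⟨⟨hp0, hp1⟩, hq0, hq1⟩ := h.mem_Ioo
  obtain ⟨-, -, -, -, heq, hfreq⟩ := h
  rw [log_quotient hp0 hp1 hq0 hq1] at heq hs
  rw [log_quotient_sq hp0 hp1 hq1] at heq
  rw [eq_div_iff (by positivity)] at hs
  set A := Real.log (1 - p) with hA
  set B := Real.log p with hB
  set C := Real.log (1 - q) with hC
  set D := Real.log q with hD
  have e2 : B = -s * l₁ + (A + D - B - C - s * l₁ - D) - (A + D - B - C) * α := by
    refine mul_left_cancel₀ h₀.ne' ?_
    linear_combination heq + l₁ * hs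
  refine ⟨A + D - B - C, 2 * (A + D - B - C - s * l₁ - D), hp0, hp1, hq0, hq1, ?_, ?_, ?_, ?_,
    hfreq⟩
  · linear_combination (1 / 2) * hs
  · linear_combination e2
  · linear_combination -e2 + (1 / 2) * hs
  · ring

/-- The cross entropy of an equilibrium state relative to any chain with the same pair frequency. -/
theorem IsGibbs.cross_entropy {l₀ l₁ α p q s t v p' q' : ℝ} (h : IsGibbs l₀ l₁ α p q s t v)
    (hden : 2 + p' - q' ≠ 0) (hfreq : 2 * p' * q' = α * (2 + p' - q')) :
    chainAvg (transition p' q') (fun a b => Real.log (transition p q a b)) =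
      -s * chainAvg (transition p' q') fun _ b => expo l₀ l₁ b := by
  rw [chainAvg_transition_expo hden, chainAvg_transition]
  simp only [transition, Matrix.cons_val_zero, Matrix.cons_val_one]
  rw [h.log_one_sub_p, h.log_p, h.log_one_sub_q, h.log_q]
  field_simp
  linear_combination t * hfreq

theorem mul_log_sub_le {x y : ℝ} (hx : 0 < x) (hy : 0 < y) :
    x * (Real.log y - Real.log x) ≤ y - x := by
  rw [← Real.log_div hy.ne' hx.ne']
  have := mul_le_mul_of_nonneg_left (Real.log_le_sub_one_of_pos (div_pos hy hx)) hx.le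
  rwa [mul_sub, mul_div_cancel₀ _ hx.ne', mul_one] at this

theorem mul_log_sub_lt {x y : ℝ} (hx : 0 < x) (hy : 0 < y) (hne : x ≠ y) :
    x * (Real.log y - Real.log x) < y - x := by
  rw [← Real.log_div hy.ne' hx.ne']
  have h1 : y / x ≠ 1 := fun h => hne ((div_eq_one_iff_eq hx.ne').1 h).symm
  have := mul_lt_mul_of_pos_left (Real.log_lt_sub_one_of_pos (div_pos hy hx) h1) hx
  rwa [mul_sub, mul_div_cancel₀ _ hx.ne', mul_one] at this

/-- The relative entropy of two Bernoulli laws. -/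
noncomputable def bernoulliDiv (x y : ℝ) : ℝ :=
  x * (Real.log x - Real.log y) + (1 - x) * (Real.log (1 - x) - Real.log (1 - y))

theorem bernoulliDiv_nonneg {x y : ℝ} (hx : 0 < x) (hx1 : x < 1) (hy : 0 < y) (hy1 : y < 1) :
    0 ≤ bernoulliDiv x y := by
  have h1 := mul_log_sub_le hx hy
  have h2 := mul_log_sub_le (sub_pos.2 hx1) (sub_pos.2 hy1)
  unfold bernoulliDiv
  linarith

theorem eq_of_bernoulliDiv_nonpos {x y : ℝ} (hx : 0 < x) (hx1 : x < 1) (hy : 0 < y) (hy1 : y < 1)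
    (h : bernoulliDiv x y ≤ 0) : x = y := by
  by_contra hne
  have h1 := mul_log_sub_lt hx hy hne
  have h2 := mul_log_sub_le (sub_pos.2 hx1) (sub_pos.2 hy1)
  unfold bernoulliDiv at h
  linarith

theorem chainAvg_transition_expo_pos {l₀ l₁ p q : ℝ} (h₀ : 0 < l₀) (h₁ : 0 < l₁) (hp0 : 0 < p)
    (hp1 : p < 1) (hq1 : q < 1) :
    0 < chainAvg (transition p q) fun _ b => expo l₀ l₁ b := by
  have hden : 0 < 2 + p - q := by linarith
  rw [chainAvg_transition_expo hden.ne']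
  have : 0 < (2 - p - q) * l₀ := mul_pos (by linarith) h₀
  positivity

/-- Both cross entropies are averaged over the primed chain; their difference is a weighted sum of
relative entropies. -/
theorem IsGibbs.bernoulliDiv_eq {l₀ l₁ α p q s t v p' q' s' t' v' : ℝ}
    (h : IsGibbs l₀ l₁ α p q s t v) (h' : IsGibbs l₀ l₁ α p' q' s' t' v') :
    (1 - p' / (2 + p' - q')) * bernoulliDiv p' p + p' / (2 + p' - q') * bernoulliDiv q' q =
      (s - s') * chainAvg (transition p' q') fun _ b => expo l₀ l₁ b := by
  have hden : 0 < 2 + p' - q' := by linarith [h'.p_pos, h'.q_lt]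
  have e1 := h.cross_entropy hden.ne' h'.freq_eq
  have e2 := h'.cross_entropy hden.ne' h'.freq_eq
  rw [chainAvg_transition] at e1 e2
  simp only [transition, Matrix.cons_val_zero, Matrix.cons_val_one] at e1 e2
  unfold bernoulliDiv
  simp only [transition]
  linear_combination e2 - e1

/-- If s ≤ s', the weighted sum of relative entropies is nonpositive, so both vanish because the
weights are positive. -/
theorem IsGibbs.eq_or_exponent_lt {l₀ l₁ α p q s t v p' q' s' t' v' : ℝ} (h₀ : 0 < l₀)
    (h₁ : 0 < l₁) (h : IsGibbs l₀ l₁ α p q s t v) (h' : IsGibbs l₀ l₁ α p' q' s' t' v') :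
    (p' = p ∧ q' = q) ∨ s' < s := by
  rw [or_iff_not_imp_right, not_lt]
  intro hs
  have hden : 0 < 2 + p' - q' := by linarith [h'.p_pos, h'.q_lt]
  have hw1 : 0 < p' / (2 + p' - q') := div_pos h'.p_pos hden
  have hw0 : 0 < 1 - p' / (2 + p' - q') := by
    rw [sub_pos, div_lt_one hden]
    linarith [h'.q_lt]
  have hL := chainAvg_transition_expo_pos h₀ h₁ h'.p_pos h'.p_lt h'.q_lt
  have e := h.bernoulliDiv_eq h'
  have hp := bernoulliDiv_nonneg h'.p_pos h'.p_lt h.p_pos h.p_lt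
  have hq := bernoulliDiv_nonneg h'.q_pos h'.q_lt h.q_pos h.q_lt
  have hR := mul_nonpos_of_nonpos_of_nonneg (sub_nonpos.2 hs) hL.le
  rw [← e] at hR
  have m0 := mul_nonneg hw0.le hp
  have m1 := mul_nonneg hw1.le hq
  exact ⟨eq_of_bernoulliDiv_nonpos h'.p_pos h'.p_lt h.p_pos h.p_lt
      (nonpos_of_mul_nonpos_right (by linarith) hw0),
    eq_of_bernoulliDiv_nonpos h'.q_pos h'.q_lt h.q_pos h.q_lt
      (nonpos_of_mul_nonpos_right (by linarith) hw1)⟩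

/-- Two different solutions would each have a strictly larger exponent than the other. -/
theorem IsSolutionPQ.unique {l₀ l₁ α p q p' q' : ℝ} (h₀ : 0 < l₀) (h₁ : 0 < l₁)
    (h : IsSolutionPQ l₀ l₁ α p q) (h' : IsSolutionPQ l₀ l₁ α p' q') : p' = p ∧ q' = q := by
  obtain ⟨t, v, hG⟩ := h.isGibbs h₀ rfl
  obtain ⟨t', v', hG'⟩ := h'.isGibbs h₀ rfl
  rcases hG.eq_or_exponent_lt h₀ h₁ hG' with h1 | h1
  · exact h1
  · rcases hG'.eq_or_exponent_lt h₀ h₁ hG with h2 | h2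
    · exact ⟨h2.1.symm, h2.2.symm⟩
    · exact absurd h1 h2.not_gt

/-- Here s times the positive Lyapunov exponent is the entropy of the chain. -/
theorem IsGibbs.exponent_nonneg {l₀ l₁ α p q s t v : ℝ} (h₀ : 0 < l₀) (h₁ : 0 < l₁)
    (h : IsGibbs l₀ l₁ α p q s t v) : 0 ≤ s := by
  have hden : 0 < 2 + p - q := by linarith [h.p_pos, h.q_lt]
  have hw1 : 0 < p / (2 + p - q) := div_pos h.p_pos hden
  have hw0 : 0 < 1 - p / (2 + p - q) := by
    rw [sub_pos, div_lt_one hden]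
    linarith [h.q_lt]
  have hL := chainAvg_transition_expo_pos h₀ h₁ h.p_pos h.p_lt h.q_lt
  have e := h.cross_entropy hden.ne' h.freq_eq
  have hent : ∀ x : ℝ, 0 < x → x < 1 → (1 - x) * Real.log (1 - x) + x * Real.log x ≤ 0 := by
    intro x hx hx1
    have h1 := mul_nonpos_of_nonneg_of_nonpos hx.le (Real.log_nonpos hx.le hx1.le)
    have h2 := mul_nonpos_of_nonneg_of_nonpos (sub_pos.2 hx1).le
      (Real.log_nonpos (sub_pos.2 hx1).le (by linarith))
    linarith
  have hneg : chainAvg (transition p q) (fun a b => Real.log (transition p q a b)) ≤ 0 := by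
    rw [chainAvg_transition]
    have h1 := mul_nonpos_of_nonneg_of_nonpos hw0.le (hent p h.p_pos h.p_lt)
    have h2 := mul_nonpos_of_nonneg_of_nonpos hw1.le (hent q h.q_pos h.q_lt)
    simp only [transition, Matrix.cons_val_zero, Matrix.cons_val_one]
    linarith
  rw [e] at hneg
  by_contra! hs
  have := mul_pos (neg_pos.2 hs) hL
  linarith

theorem IsGibbs.dimH_setLlevel {l₀ l₁ α p q s t v : ℝ} (h₀ : 0 < l₀) (h₁ : 0 < l₁)
    (hosc : Real.exp (-l₀) + Real.exp (-l₁) ≤ 1) (h : IsGibbs l₀ l₁ α p q s t v) :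
    dimH (setLlevel l₀ l₁ α) = ENNReal.ofReal s := by
  have hden : 0 < 2 + p - q := by linarith [h.p_pos, h.q_lt]
  refine le_antisymm ?_ ?_
  · have e1 := Real.exp_log (sub_pos.2 h.p_lt)
    have e2 := Real.exp_log h.p_pos
    have e3 := Real.exp_log (sub_pos.2 h.q_lt)
    have e4 := Real.exp_log h.q_pos
    rw [h.log_one_sub_p] at e1
    rw [h.log_p] at e2
    rw [h.log_one_sub_q] at e3
    rw [h.log_q] at e4
    -- With this V the exponential matrix is the transition matrix itself, so both row conditions
    -- hold with equality.
    refine dimH_setLlevel_le h₀ h₁ (h.exponent_nonneg h₀ h₁) (t := t) ![t * α, v] ?_ ?_ le_rfl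
    · simp only [Matrix.cons_val_zero, Matrix.cons_val_one]
      have f1 : Real.exp (-(s * l₀) + t * α / 2) = (1 - p) * Real.exp (t * α) := by
        rw [← e1, ← Real.exp_add]
        ring_nf
      have f2 : Real.exp (-(s * l₁) + v / 2) = p * Real.exp (t * α) := by
        rw [← e2, ← Real.exp_add]
        ring_nf
      rw [f1, f2]
      linarith
    · simp only [Matrix.cons_val_zero, Matrix.cons_val_one]
      have f1 : Real.exp (-(s * l₀) + t * α / 2) = (1 - q) * Real.exp v := by
        rw [← e3, ← Real.exp_add]
        ring_nf
      have f2 : Real.exp (t - s * l₁ + v / 2) = q * Real.exp v := by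
        rw [← e4, ← Real.exp_add]
        ring_nf
      rw [f1, f2]
      linarith
  · have hP := isStochastic_transition h.p_pos.le h.p_lt.le h.q_pos.le h.q_lt.le
    refine hP.le_dimH_of_entropy h₀ h₁ hosc
      (chainAvg_transition_expo_pos h₀ h₁ h.p_pos h.p_lt h.q_lt)
      (h.cross_entropy hden.ne' h.freq_eq) (hP.ae_mem_setAlevel ?_)
    simp only [freq, transition, Matrix.cons_val_zero, Matrix.cons_val_one]
    rw [div_mul_eq_mul_div, h.freq_eq]
    exact mul_div_cancel_right₀ _ hden.ne'

/-! ### Existence of a solution for 0 < α < 1 -/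

/-- The second equation gives q = Q(p), and Q(p) < 1 once p exceeds a = α/(2-α). On (a, 1) the first
equation becomes F(p) = 0, where F tends to -∞ at a through log(1 - Q(p)) and to +∞ at 1 through
-log(1-p). -/
theorem exists_isSolutionPQ {l₀ l₁ α : ℝ} (h₀ : 0 < l₀) (h₁ : 0 < l₁) (hα0 : 0 < α)
    (hα1 : α < 1) : ∃ p q, IsSolutionPQ l₀ l₁ α p q := by
  set a : ℝ := α / (2 - α) with ha
  have h2α : 0 < 2 - α := by linarith
  have ha0 : 0 < a := by positivity
  have ha1 : a < 1 := by
    rw [ha, div_lt_one h2α]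
    linarith
  have haα : a * (2 - α) = α := div_mul_cancel₀ _ h2α.ne'
  set Q : ℝ → ℝ := fun p => α * (2 + p) / (2 * p + α) with hQ
  have hden : ∀ p, 0 < p → 0 < 2 * p + α := fun p hp => by linarith
  have hQ0 : ∀ p, 0 < p → 0 < Q p := fun p hp => by
    have := hden p hp
    positivity
  have hQ1 : ∀ p, a < p → Q p < 1 := fun p hp => by
    rw [hQ]
    simp only
    rw [div_lt_one (hden p (ha0.trans hp))]
    nlinarith
  have hQa : Q a = 1 := by
    rw [hQ]
    simp only
    rw [div_eq_one_iff_eq (hden a ha0).ne']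
    linear_combination -haα
  have hQcont : ∀ p, 0 < p → ContinuousAt Q p := fun p hp =>
    ContinuousAt.div (by fun_prop) (by fun_prop) (hden p hp).ne'
  set c₁ := α * (l₁ - l₀) + l₀ with hc₁
  set c₂ := α * (l₁ - l₀) + l₀ + 2 * l₁ with hc₂
  have hc₁0 : 0 < c₁ := by nlinarith
  have hc₂0 : 0 < c₂ := by linarith
  set g : ℝ → ℝ := fun p => (α * (l₁ - l₀) + 2 * l₀) * Real.log p - α * (l₁ - l₀) * Real.log (Q p)
    with hg
  set F : ℝ → ℝ := fun p => g p + c₁ * Real.log (1 - Q p) - c₂ * Real.log (1 - p) with hF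
  have hgcont : ∀ p, 0 < p → ContinuousAt g p := fun p hp =>
    (continuousAt_const.mul (Real.continuousAt_log hp.ne')).sub
      (continuousAt_const.mul ((hQcont p hp).log (hQ0 p hp).ne'))
  have hFcont : ContinuousOn F (Set.Ioo a 1) := by
    intro p hp
    have hp0 := ha0.trans hp.1
    refine ContinuousAt.continuousWithinAt ?_
    refine ((hgcont p hp0).add (continuousAt_const.mul ?_)).sub (continuousAt_const.mul ?_)
    · exact (continuousAt_const.sub (hQcont p hp0)).log (sub_pos.2 (hQ1 p hp.1)).ne'
    · exact (continuousAt_const.sub continuousAt_id).log (sub_pos.2 hp.2).ne'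
  have hbot : Tendsto F (𝓝[>] a) atBot := by
    have t1 : Tendsto (fun p => 1 - Q p) (𝓝[>] a) (𝓝[>] 0) := by
      refine tendsto_nhdsWithin_iff.2 ⟨?_, ?_⟩
      · have hcont : ContinuousAt (fun p => 1 - Q p) a := continuousAt_const.sub (hQcont a ha0)
        have h := hcont.tendsto.mono_left (nhdsWithin_le_nhds (s := Set.Ioi a))
        rwa [hQa, sub_self] at h
      · filter_upwards [self_mem_nhdsWithin] with p hp
        exact sub_pos.2 (hQ1 p hp)
    have t2 := (Real.tendsto_log_nhdsGT_zero.comp t1).const_mul_atBot hc₁0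
    have t3 : Tendsto (fun p => g p - c₂ * Real.log (1 - p)) (𝓝[>] a)
        (𝓝 (g a - c₂ * Real.log (1 - a))) :=
      ((hgcont a ha0).sub (continuousAt_const.mul ((continuousAt_const.sub continuousAt_id).log
        (sub_pos.2 ha1).ne'))).tendsto.mono_left nhdsWithin_le_nhds
    refine (t3.add_atBot t2).congr fun p => ?_
    simp only [hF, Function.comp_apply]
    ring
  have htop : Tendsto F (𝓝[<] 1) atTop := by
    have t1 : Tendsto (fun p : ℝ => 1 - p) (𝓝[<] 1) (𝓝[>] 0) := by
      refine tendsto_nhdsWithin_iff.2 ⟨?_, ?_⟩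
      · have : ContinuousAt (fun p : ℝ => 1 - p) 1 := by fun_prop
        have h := this.tendsto.mono_left (nhdsWithin_le_nhds (s := Set.Iio 1))
        rwa [sub_self] at h
      · filter_upwards [self_mem_nhdsWithin] with p hp
        exact sub_pos.2 (Set.mem_Iio.1 hp)
    have t2 := (Real.tendsto_log_nhdsGT_zero.comp t1).const_mul_atBot_of_neg (neg_neg_of_pos hc₂0)
    have t3 : Tendsto (fun p => g p + c₁ * Real.log (1 - Q p)) (𝓝[<] 1)
        (𝓝 (g 1 + c₁ * Real.log (1 - Q 1))) :=
      ((hgcont 1 one_pos).add (continuousAt_const.mul ((continuousAt_const.sub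
        (hQcont 1 one_pos)).log (sub_pos.2 (hQ1 1 ha1)).ne'))).tendsto.mono_left nhdsWithin_le_nhds
    refine (t3.add_atTop t2).congr fun p => ?_
    simp only [hF, Function.comp_apply]
    ring
  obtain ⟨x, hx, hxI⟩ := ((hbot.eventually_le_atBot 0).and (Ioo_mem_nhdsGT ha1)).exists
  obtain ⟨y, hy, hyI⟩ := ((htop.eventually_ge_atTop 0).and (Ioo_mem_nhdsLT ha1)).exists
  obtain ⟨p, hp, hFp⟩ := isPreconnected_Ioo.intermediate_value hxI hyI hFcont ⟨hx, hy⟩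
  have hp0 := ha0.trans hp.1
  have hq0 := hQ0 p hp0
  have hq1 := hQ1 p hp.1
  have hp' : 0 < 1 - p := sub_pos.2 hp.2
  have hq' : 0 < 1 - Q p := sub_pos.2 hq1
  refine ⟨p, Q p, ⟨hp0.le, hp.2.le⟩, ⟨hq0.le, hq1.le⟩, by positivity, by positivity, ?_, ?_⟩
  · rw [log_quotient hp0 hp.2 hq0 hq1, log_quotient_sq hp0 hp.2 hq1]
    simp only [hF, hg, hc₁, hc₂] at hFp
    linear_combination hFp
  · have : Q p * (2 * p + α) = α * (2 + p) := div_mul_cancel₀ _ (hden p hp0).ne'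
    linear_combination this

/-! ### The set L and the level α = 0 -/

theorem exists_isRootP {l₀ l₁ : ℝ} (h₀ : 0 < l₀) (h₁ : 0 < l₁) :
    ∃ p, (0 < p ∧ p < 1) ∧ IsRootP l₀ l₁ p := by
  have hc : ContinuousOn (fun p : ℝ => p ^ (2 * l₀) - (1 - p) ^ (2 * l₁ + l₀)) (Set.Icc 0 1) := by
    refine ContinuousOn.sub ?_ ?_
    · exact continuousOn_id.rpow_const fun x _ => Or.inr (by positivity)
    · exact (continuousOn_const.sub continuousOn_id).rpow_const fun x _ => Or.inr (by positivity)
  have h2 : (2 * l₀) ≠ 0 := by positivity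
  have h3 : (2 * l₁ + l₀) ≠ 0 := by positivity
  obtain ⟨p, hp, he⟩ := intermediate_value_Icc (zero_le_one' ℝ) hc
    (show (0 : ℝ) ∈ _ by simp [Real.zero_rpow h2, Real.zero_rpow h3])
  simp only at he
  refine ⟨p, ⟨hp.1.lt_of_ne ?_, hp.2.lt_of_ne ?_⟩, hp, sub_eq_zero.1 he⟩ <;> rintro rfl
  · simp [Real.zero_rpow h2] at he
  · simp [Real.zero_rpow h3] at he

theorem IsRootP.unique {l₀ l₁ p p' : ℝ} (h₀ : 0 < l₀) (h₁ : 0 < l₁) (h : IsRootP l₀ l₁ p)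
    (h' : IsRootP l₀ l₁ p') : p' = p := by
  wlog hlt : p' < p generalizing p p'
  · rcases (not_lt.1 hlt).eq_or_lt with he | hlt'
    · exact he.symm
    · exact (this h' h hlt').symm
  obtain ⟨⟨hp0, hp1⟩, he⟩ := h
  obtain ⟨⟨hp0', hp1'⟩, he'⟩ := h'
  have e1 := Real.rpow_lt_rpow hp0' hlt (show 0 < 2 * l₀ by positivity)
  have e2 := Real.rpow_lt_rpow (show 0 ≤ 1 - p by linarith) (by linarith : 1 - p < 1 - p')
    (show 0 < 2 * l₁ + l₀ by positivity)
  linarith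

theorem IsRootP.log_eq {l₀ l₁ p s : ℝ} (h₀ : 0 < l₀) (hp0 : 0 < p) (hp1 : p < 1)
    (h : IsRootP l₀ l₁ p) (hs : s = -Real.log (1 - p) / l₀) :
    Real.log (1 - p) = -(s * l₀) ∧ Real.log p = -(s * l₁) - s * l₀ / 2 := by
  have hl : Real.log (1 - p) = -(s * l₀) := by
    rw [hs]
    field_simp
  refine ⟨hl, ?_⟩
  have := congrArg Real.log h.2
  rw [Real.log_rpow hp0, Real.log_rpow (sub_pos.2 hp1), hl] at this
  refine mul_left_cancel₀ h₀.ne' ?_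
  linear_combination (1 / 2) * this

/-- The chain with q = 0 almost surely never has two linked ones; the equation for p makes its
entropy equal to s times its Lyapunov exponent. -/
theorem IsRootP.le_dimH_setL {l₀ l₁ p s : ℝ} (h₀ : 0 < l₀) (h₁ : 0 < l₁)
    (hosc : Real.exp (-l₀) + Real.exp (-l₁) ≤ 1) (hp0 : 0 < p) (hp1 : p < 1)
    (h : IsRootP l₀ l₁ p) (hs : s = -Real.log (1 - p) / l₀) :
    ENNReal.ofReal s ≤ dimH (setL l₀ l₁) := by
  obtain ⟨e1, e2⟩ := h.log_eq h₀ hp0 hp1 hs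
  have hP := isStochastic_transition hp0.le hp1.le le_rfl zero_le_one
  refine hP.le_dimH_of_entropy h₀ h₁ hosc
    (chainAvg_transition_expo_pos h₀ h₁ hp0 hp1 zero_lt_one) ?_ (hP.ae_mem_setA rfl)
  have hden : 2 + p - 0 ≠ 0 := by linarith
  rw [chainAvg_transition_expo hden, chainAvg_transition]
  simp only [transition, Matrix.cons_val_zero, Matrix.cons_val_one]
  rw [e1, e2, sub_zero, sub_zero, sub_zero, Real.log_one]
  field_simp
  ring

/-- At α = 0 the condition on V(0) allows V(0) = 0. With ψ = exp(V(1)/2) the rows require a + bψ ≤ 1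
and a + e^t·bψ ≤ ψ². Equality in both fixes ψ and t. At the exponent s itself ψ² = a, which would
need t = -∞; hence the passage to s + δ, where ψ² > a. -/
theorem IsRootP.dimH_setLlevel_zero_le {l₀ l₁ p s : ℝ} (h₀ : 0 < l₀) (h₁ : 0 < l₁) (hp0 : 0 < p)
    (hp1 : p < 1) (h : IsRootP l₀ l₁ p) (hs : s = -Real.log (1 - p) / l₀) :
    dimH (setLlevel l₀ l₁ 0) ≤ ENNReal.ofReal s := by
  obtain ⟨e1, e2⟩ := h.log_eq h₀ hp0 hp1 hs
  have hs0 : 0 < s := by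
    have := Real.log_neg (sub_pos.2 hp1) (by linarith)
    rw [e1] at this
    nlinarith
  refine ENNReal.le_of_forall_pos_le_add fun δ hδ _ => ?_
  have hδ' : (0 : ℝ) < δ := hδ
  rw [← ENNReal.ofReal_coe_nnreal (p := δ), ← ENNReal.ofReal_add hs0.le hδ'.le]
  set s' := s + (δ : ℝ) with hs'
  set a := Real.exp (-(s' * l₀)) with ha
  set b := Real.exp (-(s' * l₁)) with hb
  have ha0 : 0 < a := Real.exp_pos _
  have hb0 : 0 < b := Real.exp_pos _
  have hap : a < 1 - p := by
    rw [← Real.exp_log (sub_pos.2 hp1), e1]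
    apply Real.exp_lt_exp.2
    nlinarith
  have hbp : b * Real.exp (-(s' * l₀) / 2) < p := by
    rw [hb, ← Real.exp_add]
    conv_rhs => rw [← Real.exp_log hp0, e2]
    apply Real.exp_lt_exp.2
    nlinarith
  set ψ := (1 - a) / b with hψ
  have hψa : Real.exp (-(s' * l₀) / 2) < ψ := by
    rw [hψ, lt_div_iff₀ hb0]
    linarith
  have hψ0 : 0 < ψ := (Real.exp_pos _).trans hψa
  have hψ2 : 0 < ψ ^ 2 - a := by
    have h1 : a = Real.exp (-(s' * l₀) / 2) ^ 2 := by
      rw [← Real.exp_nat_mul, ha]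
      congr 1
      push_cast
      ring
    rw [h1, sub_pos]
    exact pow_lt_pow_left₀ hψa (Real.exp_pos _).le two_ne_zero
  have hbψ : b * ψ = 1 - a := mul_div_cancel₀ _ hb0.ne'
  refine dimH_setLlevel_le h₀ h₁ (by positivity) (t := Real.log ((ψ ^ 2 - a) / (b * ψ)))
    ![0, 2 * Real.log ψ] ?_ ?_ (by simp)
  · simp only [Matrix.cons_val_zero, Matrix.cons_val_one]
    rw [mul_div_cancel_left₀ _ (two_ne_zero' ℝ), Real.exp_add _ (Real.log ψ), Real.exp_log hψ0,
      zero_div, add_zero, ← ha, ← hb, hbψ, Real.exp_zero]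
    linarith
  · simp only [Matrix.cons_val_zero, Matrix.cons_val_one]
    have e3 : Real.exp (2 * Real.log ψ) = ψ ^ 2 := by
      rw [two_mul, Real.exp_add, Real.exp_log hψ0, sq]
    rw [mul_div_cancel_left₀ _ (two_ne_zero' ℝ), Real.exp_add _ (Real.log ψ), sub_eq_add_neg,
      Real.exp_add (Real.log _), Real.exp_log hψ0, Real.exp_log (by positivity), zero_div, add_zero,
      ← ha, ← hb, e3, mul_assoc, div_mul_cancel₀ _ (by positivity)]
    linarith

/-! ### Small dimension near α = 1 -/

/-- With V = (t + κ, 2t) and κ < 0, the condition V(0) ≤ tα holds for all α ≥ 1 + κ/t, a bound below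
1. The rows leave room for this for every s > 0 because b < 1. -/
theorem exists_dimH_setLlevel_le {l₀ l₁ s : ℝ} (h₀ : 0 < l₀) (h₁ : 0 < l₁) (hs : 0 < s) :
    ∃ α₀ < 1, ∀ α, α₀ ≤ α → dimH (setLlevel l₀ l₁ α) ≤ ENNReal.ofReal s := by
  set a := Real.exp (-(s * l₀)) with ha
  set b := Real.exp (-(s * l₁)) with hb
  have ha0 : 0 < a := Real.exp_pos _
  have hb0 : 0 < b := Real.exp_pos _
  have ha1 : a < 1 := Real.exp_lt_one_iff.2 (by have := mul_pos hs h₀; linarith)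
  have hb1 : b < 1 := Real.exp_lt_one_iff.2 (by have := mul_pos hs h₁; linarith)
  -- T = e^{t/2}, and e^κ = (1 + b)/2 lies midway between b and 1. The value of T makes bT² + T =
  -- T²e^κ, which settles the first row once the a-term is bounded by T.
  set T := 2 / (1 - b) with hT
  have hbT : T * (1 - b) = 2 := div_mul_cancel₀ _ (by linarith)
  have hT1 : 1 < T := by
    rw [hT, lt_div_iff₀ (by linarith)]
    linarith
  have hT0 : 0 < T := by linarith
  set t := 2 * Real.log T with ht
  have ht0 : 0 < t := mul_pos two_pos (Real.log_pos hT1)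
  set κ := Real.log ((1 + b) / 2) with hκ
  have hκ0 : κ < 0 := Real.log_neg (by linarith) (by linarith)
  have eκ : Real.exp κ = (1 + b) / 2 := Real.exp_log (by linarith)
  have et2 : Real.exp (t / 2) = T := by
    rw [ht, mul_div_cancel_left₀ _ (two_ne_zero' ℝ), Real.exp_log hT0]
  have et : Real.exp t = T ^ 2 := by
    rw [← et2, ← Real.exp_nat_mul]
    congr 1
    push_cast
    ring
  have hroot : a * Real.exp ((t + κ) / 2) ≤ T := by
    have h1 : Real.exp ((t + κ) / 2) ≤ T := by
      rw [← et2]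
      apply Real.exp_le_exp.2
      linarith
    calc a * Real.exp ((t + κ) / 2) ≤ 1 * T := by gcongr
      _ = T := one_mul T
  refine ⟨(t + κ) / t, ?_, fun α hα => ?_⟩
  · rw [div_lt_one ht0]
    linarith
  refine dimH_setLlevel_le h₀ h₁ hs.le (t := t) ![t + κ, 2 * t] ?_ ?_ ?_
  · simp only [Matrix.cons_val_zero, Matrix.cons_val_one]
    rw [mul_div_cancel_left₀ _ (two_ne_zero' ℝ), Real.exp_add _ t, Real.exp_add _ ((t + κ) / 2),
      Real.exp_add t κ, ← ha, ← hb, et, eκ]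
    have : b * T ^ 2 + T = T ^ 2 * ((1 + b) / 2) := by linear_combination (-T / 2) * hbT
    linarith
  · simp only [Matrix.cons_val_zero, Matrix.cons_val_one]
    have e3 : Real.exp (t - s * l₁ + 2 * t / 2) = b * T ^ 4 := by
      rw [show t - s * l₁ + 2 * t / 2 = -(s * l₁) + (t + t) by ring, Real.exp_add, Real.exp_add,
        et, ← hb]
      ring
    rw [e3, Real.exp_add _ ((t + κ) / 2), ← ha, two_mul, Real.exp_add, et]
    have h2 : T ^ 2 * T ^ 2 - b * T ^ 4 = 2 * T ^ 3 := by linear_combination T ^ 3 * hbT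
    have h3 : T ≤ T ^ 3 := le_self_pow₀ hT1.le (by norm_num)
    linarith [pow_pos hT0 3]
  · simp only [Matrix.cons_val_zero]
    rw [div_le_iff₀ ht0] at hα
    linarith

/-- The difference of the two sides is (1-q)(1+2p) + (1-p), a sum of nonnegative terms on the unit
square. -/
theorem two_mul_mul_eq_iff {p q : ℝ} (hp : p ∈ Set.Icc (0 : ℝ) 1) (hq : q ∈ Set.Icc (0 : ℝ) 1) :
    2 * p * q = 1 * (2 + p - q) ↔ p = 1 ∧ q = 1 := by
  constructor
  · intro h
    have h1 : (1 - q) * (1 + 2 * p) + (1 - p) = 0 := by linear_combination -h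
    have h2 : 0 ≤ (1 - q) * (1 + 2 * p) :=
      mul_nonneg (by linarith [hq.2]) (by linarith [hp.1])
    have hp1 : p = 1 := by linarith [hp.2]
    subst hp1
    exact ⟨rfl, by linarith⟩
  · rintro ⟨rfl, rfl⟩
    norm_num

theorem coe_ofReal_eq {s : ℝ} (hs : 0 ≤ s) :
    ((ENNReal.ofReal s : ENNReal) : EReal) = (s : EReal) := by
  rw [EReal.coe_ennreal_ofReal, max_eq_left hs]

end MultipleErgodicIFS

/-! ### The theorem -/

open MultipleErgodicIFS in
theorem theorem3 (l₀ l₁ : ℝ) (h₀ : 0 < l₀) (h₁ : 0 < l₁)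
    (hosc : Real.exp (-l₀) + Real.exp (-l₁) ≤ 1) :
    (∃ p : ℝ, IsRootP l₀ l₁ p ∧ (∀ p' : ℝ, IsRootP l₀ l₁ p' → p' = p) ∧
      ((dimH (setL l₀ l₁) : ENNReal) : EReal) = ((-Real.log (1 - p) / l₀ : ℝ) : EReal) ∧
      ((dimH (setLlevel l₀ l₁ 0) : ENNReal) : EReal) = ((-Real.log (1 - p) / l₀ : ℝ) : EReal)) ∧
    (∀ α : ℝ, 0 < α → α < 1 →
      ∃ p q : ℝ, IsSolutionPQ l₀ l₁ α p q ∧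
        (∀ p' q' : ℝ, IsSolutionPQ l₀ l₁ α p' q' → p' = p ∧ q' = q) ∧
        ((dimH (setLlevel l₀ l₁ α) : ENNReal) : EReal) =
          (((α * Real.log (p * (1 - q) / ((1 - p) * q)) - 2 * Real.log (1 - p)) / (2 * l₀) : ℝ) :
            EReal)) ∧
    -- The case `α = 1`: the second equation leaves only `(p, q) = (1, 1)`, where the formula is
    -- read as its limit for `α → 1`, which is `0`.
    ((∀ p q : ℝ, p ∈ Set.Icc (0 : ℝ) 1 → q ∈ Set.Icc (0 : ℝ) 1 →
        (2 * p * q = 1 * (2 + p - q) ↔ p = 1 ∧ q = 1)) ∧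
      Tendsto (fun α : ℝ => dimH (setLlevel l₀ l₁ α)) (𝓝[<] 1) (𝓝 0) ∧
      dimH (setLlevel l₀ l₁ 1) = 0) := by
  -- One bound, uniform on α ≥ α₀, serves both the limit at 1 and the level α = 1 itself.
  have hsmall : ∀ ε : ENNReal, 0 < ε → ∃ α₀ < (1 : ℝ), ∀ α, α₀ ≤ α →
      dimH (setLlevel l₀ l₁ α) ≤ ε := by
    intro ε hε
    obtain ⟨s, hs0, hsε⟩ := ENNReal.lt_iff_exists_nnreal_btwn.1 hε
    obtain ⟨α₀, h, hα₀⟩ := exists_dimH_setLlevel_le h₀ h₁ (s := (s : ℝ)) (by exact_mod_cast hs0)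
    refine ⟨α₀, h, fun α hα => (hα₀ α hα).trans ?_⟩
    rw [ENNReal.ofReal_coe_nnreal]
    exact hsε.le
  refine ⟨?_, fun α hα0 hα1 => ?_, fun p q hp hq => two_mul_mul_eq_iff hp hq, ?_, ?_⟩
  · obtain ⟨p, ⟨hp0, hp1⟩, hp⟩ := exists_isRootP h₀ h₁
    have hs : 0 ≤ -Real.log (1 - p) / l₀ :=
      div_nonneg (neg_nonneg.2 (Real.log_nonpos (by linarith) (by linarith))) h₀.le
    have hlow := hp.le_dimH_setL h₀ h₁ hosc hp0 hp1 rfl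
    have hmono := dimH_mono (setL_subset_setLlevel_zero l₀ l₁)
    have hup := hp.dimH_setLlevel_zero_le h₀ h₁ hp0 hp1 rfl
    refine ⟨p, hp, fun p' hp' => hp.unique h₀ h₁ hp', ?_, ?_⟩
    · rw [le_antisymm (hmono.trans hup) hlow, coe_ofReal_eq hs]
    · rw [le_antisymm hup (hlow.trans hmono), coe_ofReal_eq hs]
  · obtain ⟨p, q, hpq⟩ := exists_isSolutionPQ h₀ h₁ hα0 hα1
    obtain ⟨t, v, hG⟩ := hpq.isGibbs h₀ rfl
    refine ⟨p, q, hpq, fun p' q' h' => hpq.unique h₀ h₁ h', ?_⟩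
    rw [hG.dimH_setLlevel h₀ h₁ hosc, coe_ofReal_eq (hG.exponent_nonneg h₀ h₁)]
  · refine ENNReal.tendsto_nhds_zero.2 fun ε hε => ?_
    obtain ⟨α₀, h, hα₀⟩ := hsmall ε hε
    filter_upwards [Ioo_mem_nhdsLT h] with α hα
    exact hα₀ α hα.1.le
  · refine le_antisymm (ENNReal.le_of_forall_pos_le_add fun ε hε _ => ?_) zero_le
    obtain ⟨α₀, h, hα₀⟩ := hsmall ε (by exact_mod_cast hε)
    rw [zero_add]
    exact hα₀ 1 h.le
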